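/- **Definitions.** A $k$-graph $H=(V,E)$ consists of a finite vertex set $V$ and an edge set $E$ of $k$-element subsets of $V$. For a set $S$ of $k-1$ vertices let $\deg_H(S)$ be the number of vertices $v\notin S$ with $S\cup\{v\}\in E$; the minimum codegree $\delta_{k-1}(H)$ is the minimum of $\deg_H(S)$ over all $(k-1)$-element sets $S\subseteq V$. The binomial random $k$-graph $\mathbb G^{(k)}(n,p)$ has $n$ vertices, and each $k$-element set of vertices is an edge independently with probability $p$. A $k$-graph on $m\ge k+r-1$ vertices is an $r$-th power of a tight cycle if its vertices can be ordered cyclically so that any $k+r-1$ consecutive vertices span a complete $k$-graph and there are no edges other than those forced by this condition. A $k$-graph contains the $r$-th power of a tight Hamilton cycle if it has a spanning subgraph that is an $r$-th power of a tight cycle. **Theorem 1.3 (Main result).** For all integers $k\ge 2$ and $r\ge 1$ with $k+r\ge 4$ and every real $\alpha>0$ there is $\epsilon>0$ such that the following holds. For each $n$ let $H=H_n$ be a $k$-graph on $n$ vertices and let $p=p(n)\in[0,1]$, and suppose that, for all sufficiently large $n$, $$\delta_{k-1}(H)\ \ge\ \left(1-\binom{k+r-2}{k-1}^{-1}+\alpha\right)n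 \qquad\text{and}\qquad p\ \ge\ n^{-\binom{k+r-2}{k-1}^{-1}-\epsilon}.$$ Then, with $\mathbb G^{(k)}(n,p)$ taken on the vertex set of $H$, asymptotically almost surely, that is, with probability tending to $1$ as $n\to\infty$, the union $H\cup\mathbb G^{(k)}(n,p)$ contains the $r$-th power of a tight Hamilton cycle. -/

import Mathlib

open Filter Topology MeasureTheory

/-- A `k`-uniform hypergraph (`k`-graph) with vertex set `V`: every edge is a `k`-element subset
of `V`. -/
@[ext]
structure KGraph (k : ℕ) (V : Type*) where
  /-- The edge set. -/
  edges : Set (Finset V)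
  /-- Every edge has exactly `k` elements. -/
  card_eq : ∀ e ∈ edges, e.card = k

namespace KGraph

/-- The `k`-graph whose edges are the `k`-element members of a given family of vertex sets. -/
def ofEdges (k : ℕ) {V : Type*} (E : Set (Finset V)) : KGraph k V where
  edges := {e ∈ E | e.card = k}
  card_eq := fun _ he => he.2

/-- The union of two `k`-graphs on the same vertex set. -/
instance (k : ℕ) (V : Type*) : Union (KGraph k V) where
  union G H :=
    { edges := G.edges ∪ H.edges
      card_eq := fun e he => he.elim (G.card_eq e) (H.card_eq e) }

/-- The neighbourhood `N_H(S)`: all `(k - |S|)`-sets `T` such that `S ∪ T` is an edge. -/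
def neighborhood {k : ℕ} {V : Type*} [DecidableEq V] (H : KGraph k V) (S : Finset V) :
    Set (Finset V) :=
  {T | T.card = k - S.card ∧ S ∪ T ∈ H.edges}

/-- The degree `deg_H(S) = |N_H(S)|` of a vertex set `S`. -/
noncomputable def degree {k : ℕ} {V : Type*} [DecidableEq V] (H : KGraph k V) (S : Finset V) : ℕ :=
  (H.neighborhood S).ncard

/-- The minimum `d`-degree `δ_d(H)`: the minimum of `deg_H(S)` over all `d`-element vertex
sets `S`. -/
noncomputable def minDegree {k : ℕ} {V : Type*} [DecidableEq V] (H : KGraph k V) (d : ℕ) : ℕ :=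
  sInf (H.degree '' {S : Finset V | S.card = d})

/-- The minimum codegree `δ_{k-1}(H)`. -/
noncomputable def minCodegree {k : ℕ} {V : Type*} [DecidableEq V] (H : KGraph k V) : ℕ :=
  H.minDegree (k - 1)

/-- Given a cyclic ordering `v` of the vertices, the set of the `h` consecutive vertices that
start at position `i`. -/
def window {V : Type*} [DecidableEq V] {m : ℕ} (v : ZMod m ≃ V) (h : ℕ) (i : ZMod m) : Finset V :=
  (Finset.range h).image fun j : ℕ => v (i + (j : ZMod m))

/-- `F` is the `r`-th power of a tight cycle: it has at least `k + r - 1` vertices, and these can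
be ordered cyclically so that the edges of `F` are exactly the `k`-element sets contained in some
set of `k + r - 1` consecutive vertices. Thus each `k + r - 1` consecutive vertices
span a complete `k`-graph, and there are no other edges than the ones forced by this. -/
def IsTightCyclePower {k : ℕ} {V : Type*} [DecidableEq V] (F : KGraph k V) (r : ℕ) : Prop :=
  k + r - 1 ≤ Nat.card V ∧
    ∃ v : ZMod (Nat.card V) ≃ V,
      ∀ e : Finset V, e ∈ F.edges ↔ e.card = k ∧ ∃ i, e ⊆ window v (k + r - 1) i

/-- `G` contains the `r`-th power of a tight Hamilton cycle, that is, it has a spanning subgraph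
that is the `r`-th power of a tight cycle. -/
def ContainsTightHamiltonCyclePower {k : ℕ} {V : Type*} [DecidableEq V] (G : KGraph k V) (r : ℕ) :
    Prop :=
  ∃ F : KGraph k V, F.edges ⊆ G.edges ∧ F.IsTightCyclePower r

/-- `KGraph k V` is finite for finite `V`; every set of `k`-graphs is an event. -/
instance (k : ℕ) (V : Type*) : MeasurableSpace (KGraph k V) := ⊤

/-- The law of the binomial random `k`-graph on the finite vertex set `V`: each `k`-element subset
of `V` is an edge independently with probability `p`. -/
noncomputable def binomialRandom (k : ℕ) (V : Type*) [Finite V] (p : unitInterval) :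
    Measure (KGraph k V) :=
  (ProbabilityTheory.setBernoulli {e : Finset V | e.card = k} p).map (ofEdges k)

instance (k : ℕ) (V : Type*) [Finite V] (p : unitInterval) :
    IsProbabilityMeasure (binomialRandom k V p) :=
  Measure.isProbabilityMeasure_map Measurable.of_discrete.aemeasurable

end KGraph

/-! Put `h = k + r - 2` and `C = h.choose (k - 1)`. The power of a tight cycle is a cyclic list of
vertices in which every `k`-set inside `h + 1` consecutive entries is an edge.

What `H` provides: each set of at most `h` vertices has linearly many common neighbours
(`KGraph.le_card_commonNbhd`), so path powers extend freely at either end. Joining two given ends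
needs edges across the junction, and these come from the random graph.

What the random graph `G` provides: two path powers of bounded size that share an edge and meet in
`w` vertices share at most `C * (w - 1) - 1` edges. The spare edge pays for `ε`, and Janson's
inequality shows that a given family of `c * n ^ s` tuples contains no path power of `G` with
probability at most `exp (-c' * n ^ (1 + δ))`. This survives a union bound over `n ^ O(n)` families
(`tendsto_binomialRandom_not_hit`). So one exposure of `G` hits every dense family from a collection
depending on `H` alone, and the rest is deterministic.

The deterministic part (`exists_spanning_cycle_of_hit`) is the absorption method. An absorber is a
path power of `G` on `2 * h` vertices which remains one, now by edges of `H`, when `v` is inserted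
in its middle. A connector consists of two halves, each extending one end by edges of `H`, with `G`
supplying the edges between the halves. Linearly many disjoint absorbers are chosen by
multiplicative weights so that every vertex has linearly many. They are connected, a small reservoir
is set aside, long path powers of `G` cover almost everything else, all pieces are joined cyclically
through the reservoir, and each vertex left over is inserted into an absorber of its own. -/

/-! ### Random subsets as weighted finite sums, and Janson's inequality. -/

section BinomialSubset

open Finset

variable {α ι : Type*} [DecidableEq α] [DecidableEq ι]

/-- Expectation of `g` over a random subset of `Ω` containing each element independently with
probability `p`. -/
noncomputable def bernExp (Ω : Finset α) (p : ℝ) (g : Finset α → ℝ) : ℝ :=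
  ∑ ω ∈ Ω.powerset, p ^ #ω * (1 - p) ^ #(Ω \ ω) * g ω

lemma bernExp_congr {Ω : Finset α} {p : ℝ} {g g' : Finset α → ℝ} (h : ∀ ω ⊆ Ω, g ω = g' ω) :
    bernExp Ω p g = bernExp Ω p g' :=
  sum_congr rfl fun ω hω => by rw [h ω (mem_powerset.1 hω)]

lemma bernExp_mono {Ω : Finset α} {p : ℝ} (hp0 : 0 ≤ p) (hp1 : p ≤ 1) {g g' : Finset α → ℝ}
    (h : ∀ ω ⊆ Ω, g ω ≤ g' ω) : bernExp Ω p g ≤ bernExp Ω p g' :=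
  sum_le_sum fun ω hω => mul_le_mul_of_nonneg_left (h ω (mem_powerset.1 hω))
    (mul_nonneg (pow_nonneg hp0 _) (pow_nonneg (by linarith) _))

lemma bernExp_add (Ω : Finset α) (p : ℝ) (g g' : Finset α → ℝ) :
    bernExp Ω p (fun ω => g ω + g' ω) = bernExp Ω p g + bernExp Ω p g' := by
  simp only [bernExp, mul_add, sum_add_distrib]

lemma bernExp_sub (Ω : Finset α) (p : ℝ) (g g' : Finset α → ℝ) :
    bernExp Ω p (fun ω => g ω - g' ω) = bernExp Ω p g - bernExp Ω p g' := by
  simp only [bernExp, mul_sub, sum_sub_distrib]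

lemma bernExp_const_mul (Ω : Finset α) (p c : ℝ) (g : Finset α → ℝ) :
    bernExp Ω p (fun ω => c * g ω) = c * bernExp Ω p g := by
  simp only [bernExp, mul_sum]
  exact sum_congr rfl fun ω _ => by ring

lemma bernExp_sum {κ : Type*} (Ω : Finset α) (p : ℝ) (s : Finset κ) (g : κ → Finset α → ℝ) :
    bernExp Ω p (fun ω => ∑ j ∈ s, g j ω) = ∑ j ∈ s, bernExp Ω p (g j) := by
  simp only [bernExp, mul_sum]
  exact sum_comm

lemma bernExp_insert {Ω : Finset α} {a : α} (ha : a ∉ Ω) (p : ℝ) (g : Finset α → ℝ) :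
    bernExp (insert a Ω) p g
      = p * bernExp Ω p (fun ω => g (insert a ω)) + (1 - p) * bernExp Ω p g := by
  rw [bernExp, sum_powerset_insert ha, bernExp, bernExp, mul_sum, mul_sum, add_comm]
  congr 1
  · refine sum_congr rfl fun ω hω => ?_
    have haω : a ∉ ω := fun h => ha (mem_powerset.1 hω h)
    rw [card_insert_of_notMem haω, insert_sdiff_insert, sdiff_insert_of_notMem ha]
    ring
  · refine sum_congr rfl fun ω hω => ?_
    have haω : a ∉ ω := fun h => ha (mem_powerset.1 hω h)
    rw [insert_sdiff_of_notMem _ haω, card_insert_of_notMem (by simp [ha])]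
    ring

lemma bernExp_one (Ω : Finset α) (p : ℝ) : bernExp Ω p (fun _ => 1) = 1 := by
  induction Ω using Finset.induction_on with
  | empty => simp [bernExp]
  | insert a Ω ha ih => rw [bernExp_insert ha, ih]; ring

/-- Conditioned on containing `A`, the random set is distributed like `ω ∪ A`. This is all the
independence that Janson's inequality needs below. -/
lemma bernExp_subset_ite {Ω A : Finset α} (hA : A ⊆ Ω) (p : ℝ) (g : Finset α → ℝ) :
    bernExp Ω p (fun ω => if A ⊆ ω then g ω else 0)
      = p ^ #A * bernExp Ω p (fun ω => g (ω ∪ A)) := by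
  induction Ω using Finset.induction_on generalizing A g with
  | empty =>
    obtain rfl : A = ∅ := subset_empty.1 hA
    simp
  | insert a Ω ha ih =>
    rw [bernExp_insert ha, bernExp_insert ha]
    by_cases haA : a ∈ A
    · have hA' : A.erase a ⊆ Ω := by
        intro x hx
        rw [mem_erase] at hx
        exact (mem_insert.1 (hA hx.2)).resolve_left hx.1
      have h0 : bernExp Ω p (fun ω => if A ⊆ ω then g ω else 0) = 0 := by
        rw [bernExp_congr (g' := fun _ => 0 * 1), bernExp_const_mul, zero_mul]
        intro ω hω
        rw [if_neg fun h => ha (hω (h haA)), zero_mul]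
      have h1 := ih hA' (fun ω => g (insert a ω))
      simp only [← subset_insert_iff] at h1
      rw [h0, h1, ← card_erase_add_one haA, pow_succ]
      have h2 : ∀ ω, insert a (ω ∪ A.erase a) = ω ∪ A := fun ω => by
        rw [← union_insert, insert_erase haA]
      have h3 : ∀ ω, insert a ω ∪ A = ω ∪ A := fun ω => by
        rw [insert_union, insert_eq_of_mem (mem_union_right _ haA)]
      simp only [h2, h3]
      ring
    · have hA' : A ⊆ Ω := (subset_insert_iff_of_notMem haA).1 hA
      have h1 := ih hA' (fun ω => g (insert a ω))
      have h2 := ih hA' g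
      simp only [subset_insert_iff_of_notMem haA, insert_union]
      rw [h1, h2]
      ring

lemma bernExp_subset {Ω A : Finset α} (hA : A ⊆ Ω) (p : ℝ) :
    bernExp Ω p (fun ω => if A ⊆ ω then 1 else 0) = p ^ #A := by
  rw [bernExp_subset_ite hA p (fun _ => 1), bernExp_one, mul_one]

lemma exists_le_bernExp (Ω : Finset α) {p : ℝ} (hp0 : 0 ≤ p) (hp1 : p ≤ 1)
    (g : Finset α → ℝ) : ∃ ω ⊆ Ω, g ω ≤ bernExp Ω p g := by
  by_contra! h
  obtain ⟨ω₀, h₀, hmin⟩ := exists_min_image Ω.powerset g ⟨∅, empty_mem_powerset _⟩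
  have h1 : bernExp Ω p (fun _ => g ω₀ * 1) ≤ bernExp Ω p g :=
    bernExp_mono hp0 hp1 fun ω hω => by rw [mul_one]; exact hmin ω (mem_powerset.2 hω)
  rw [bernExp_const_mul, bernExp_one, mul_one] at h1
  exact absurd (h ω₀ (mem_powerset.1 h₀)) (not_lt.2 h1)

/-- The probability that the random subset of `Ω` contains no `A i` with `i ∈ S`. -/
noncomputable def avoidProb (Ω : Finset α) (p : ℝ) (A : ι → Finset α) (S : Finset ι) : ℝ :=
  bernExp Ω p fun ω => if ∀ i ∈ S, ¬ A i ⊆ ω then 1 else 0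

omit [DecidableEq ι] in
lemma avoidProb_nonneg {Ω : Finset α} {p : ℝ} (hp0 : 0 ≤ p) (hp1 : p ≤ 1) (A : ι → Finset α)
    (S : Finset ι) : 0 ≤ avoidProb Ω p A S :=
  sum_nonneg fun ω _ => mul_nonneg
    (mul_nonneg (pow_nonneg hp0 _) (pow_nonneg (by linarith) _)) (by dsimp only; split_ifs <;> norm_num)

omit [DecidableEq ι] in
lemma avoidProb_anti {Ω : Finset α} {p : ℝ} (hp0 : 0 ≤ p) (hp1 : p ≤ 1) (A : ι → Finset α)
    {S S' : Finset ι} (h : S ⊆ S') : avoidProb Ω p A S' ≤ avoidProb Ω p A S := by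
  refine bernExp_mono hp0 hp1 fun ω _ => ?_
  split_ifs with h1 h2 h2
  · exact le_rfl
  · exact absurd (fun i hi => h1 i (h hi)) h2
  · norm_num
  · exact le_rfl

/-- The event `A i ⊆ ω` is independent of the sets `A j` disjoint from `A i`. The other `A j` are
handled by a union bound: forcing `A i ∪ A j ⊆ ω` only makes it harder to avoid the disjoint ones,
so no general correlation inequality is required. -/
lemma avoidProb_insert_le {Ω : Finset α} {p : ℝ} (hp0 : 0 ≤ p) (hp1 : p ≤ 1)
    (A : ι → Finset α) (hA : ∀ i, A i ⊆ Ω) (S : Finset ι) (i : ι) :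
    avoidProb Ω p A (insert i S) ≤ avoidProb Ω p A S *
      (1 - (p ^ #(A i) - ∑ j ∈ S with ¬ Disjoint (A i) (A j), p ^ #(A i ∪ A j))) := by
  set x := p ^ #(A i) - ∑ j ∈ S with ¬ Disjoint (A i) (A j), p ^ #(A i ∪ A j) with hx
  have hS0 := avoidProb_nonneg (Ω := Ω) hp0 hp1 A S
  -- For negative `x` the last factor exceeds one, and monotonicity in `S` suffices.
  rcases lt_or_ge x 0 with hneg | hpos
  · have := avoidProb_anti (Ω := Ω) hp0 hp1 A (subset_insert i S)
    nlinarith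
  set S₀ := S.filter fun j => Disjoint (A i) (A j) with hS₀
  set D₀ : Finset α → ℝ := fun ω => if ∀ j ∈ S₀, ¬ A j ⊆ ω then 1 else 0 with hD₀
  have hS₀S : S₀ ⊆ S := filter_subset _ _
  have e1 : bernExp Ω p (fun ω => if A i ⊆ ω then D₀ ω else 0)
      = p ^ #(A i) * avoidProb Ω p A S₀ := by
    rw [bernExp_subset_ite (hA i)]
    congr 1
    refine bernExp_congr fun ω _ => ?_
    have : (∀ j ∈ S₀, ¬ A j ⊆ ω ∪ A i) ↔ ∀ j ∈ S₀, ¬ A j ⊆ ω := by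
      refine forall₂_congr fun j hj => not_congr ?_
      have hd : Disjoint (A j) (A i) := (mem_filter.1 hj).2.symm
      exact ⟨fun h => hd.left_le_of_le_sup_right h, fun h => h.trans subset_union_left⟩
    simp only [hD₀, this]
  have e2 : ∀ j, bernExp Ω p (fun ω => if A i ∪ A j ⊆ ω then D₀ ω else 0)
      ≤ p ^ #(A i ∪ A j) * avoidProb Ω p A S₀ := by
    intro j
    rw [bernExp_subset_ite (union_subset (hA i) (hA j))]
    refine mul_le_mul_of_nonneg_left ?_ (pow_nonneg hp0 _)
    refine bernExp_mono hp0 hp1 fun ω _ => ?_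
    simp only [hD₀]
    split_ifs with h1 h2 h2
    · exact le_rfl
    · exact absurd (fun j' hj' h => h1 j' hj' (h.trans subset_union_left)) h2
    · norm_num
    · exact le_rfl
  -- A pointwise inequality: if `ω` contains `A i` and some `A j` with `j ∈ S`, then either `j ∈ S₀`
  -- and `D₀ ω = 0`, or the term of `j` in the sum cancels `D₀ ω`.
  have e3 : avoidProb Ω p A (insert i S) + bernExp Ω p (fun ω => (if A i ⊆ ω then D₀ ω else 0) -
      ∑ j ∈ S with ¬ Disjoint (A i) (A j), (if A i ∪ A j ⊆ ω then D₀ ω else 0))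
      ≤ avoidProb Ω p A S := by
    rw [avoidProb, ← bernExp_add]
    refine bernExp_mono hp0 hp1 fun ω _ => ?_
    have hnn : ∀ j ∈ S.filter (fun j => ¬ Disjoint (A i) (A j)),
        (0 : ℝ) ≤ (if A i ∪ A j ⊆ ω then D₀ ω else 0) := fun j _ => by
      simp only [hD₀]; split_ifs <;> norm_num
    have hsum := sum_nonneg hnn
    by_cases hi : A i ⊆ ω
    · have h1 : ¬ ∀ j ∈ insert i S, ¬ A j ⊆ ω := fun h => h i (mem_insert_self _ _) hi
      rw [if_neg h1, if_pos hi, zero_add]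
      by_cases hS : ∀ j ∈ S, ¬ A j ⊆ ω
      · rw [if_pos hS]
        have : D₀ ω ≤ 1 := by simp only [hD₀]; split_ifs <;> norm_num
        linarith
      · rw [if_neg hS]
        by_cases h0 : ∀ j ∈ S₀, ¬ A j ⊆ ω
        · push Not at hS
          obtain ⟨j, hj, hjω⟩ := hS
          have hj' : j ∈ S.filter (fun j => ¬ Disjoint (A i) (A j)) :=
            mem_filter.2 ⟨hj, fun hd => h0 j (mem_filter.2 ⟨hj, hd⟩) hjω⟩
          have := single_le_sum hnn hj'
          rw [if_pos (union_subset hi hjω)] at this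
          linarith
        · have : D₀ ω = 0 := if_neg h0
          linarith
    · have h1 : (∀ j ∈ insert i S, ¬ A j ⊆ ω) ↔ ∀ j ∈ S, ¬ A j ⊆ ω := by
        rw [forall_mem_insert]; simp [hi]
      rw [if_neg hi]
      simp only [h1]
      linarith
  rw [bernExp_sub, bernExp_sum, e1] at e3
  have e4 := sum_le_sum fun j (_ : j ∈ S.filter (fun j => ¬ Disjoint (A i) (A j))) => e2 j
  rw [← sum_mul] at e4
  have e5 := avoidProb_anti (Ω := Ω) hp0 hp1 A hS₀S
  have e6 : x * avoidProb Ω p A S ≤ x * avoidProb Ω p A S₀ := mul_le_mul_of_nonneg_left e5 hpos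
  rw [hx] at e6 ⊢
  linarith

/-- Iterate the one-step bound with `1 - x ≤ exp (-x)`. Each pair is counted in both orders, which
costs only a constant factor. -/
lemma avoidProb_le_exp {Ω : Finset α} {p : ℝ} (hp0 : 0 ≤ p) (hp1 : p ≤ 1)
    (A : ι → Finset α) (hA : ∀ i, A i ⊆ Ω) (S : Finset ι) :
    avoidProb Ω p A S ≤ Real.exp (-(∑ i ∈ S, p ^ #(A i)) +
      ∑ i ∈ S, ∑ j ∈ S, if j ≠ i ∧ ¬ Disjoint (A i) (A j) then p ^ #(A i ∪ A j) else 0) := by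
  induction S using Finset.induction_on with
  | empty => simp [avoidProb, bernExp_one]
  | insert i S hi ih =>
    refine (avoidProb_insert_le hp0 hp1 A hA S i).trans ?_
    set x := p ^ #(A i) - ∑ j ∈ S with ¬ Disjoint (A i) (A j), p ^ #(A i ∪ A j) with hx
    have h1 : 1 - x ≤ Real.exp (-x) := by linarith [Real.add_one_le_exp (-x)]
    have h0 := avoidProb_nonneg (Ω := Ω) hp0 hp1 A S
    calc avoidProb Ω p A S * (1 - x) ≤ avoidProb Ω p A S * Real.exp (-x) :=
          mul_le_mul_of_nonneg_left h1 h0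
      _ ≤ _ := mul_le_mul_of_nonneg_right ih (Real.exp_pos _).le
      _ ≤ _ := by
        rw [← Real.exp_add]
        apply Real.exp_le_exp.2
        have hnn : ∀ a b : ι, (0 : ℝ) ≤
            (if a ≠ b ∧ ¬ Disjoint (A b) (A a) then p ^ #(A b ∪ A a) else 0) := fun a b => by
          split_ifs
          · exact pow_nonneg hp0 _
          · exact le_rfl
        rw [sum_insert hi, sum_insert hi]
        simp only [sum_insert hi, sum_add_distrib]
        have h2 : ∑ j ∈ S with ¬ Disjoint (A i) (A j), p ^ #(A i ∪ A j)
            = ∑ j ∈ S, if j ≠ i ∧ ¬ Disjoint (A i) (A j) then p ^ #(A i ∪ A j) else 0 := by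
          rw [sum_filter]
          refine sum_congr rfl fun j hj => ?_
          have : j ≠ i := fun h => hi (h ▸ hj)
          simp [this]
        have h3 := hnn i i
        have h4 := sum_nonneg fun b (_ : b ∈ S) => hnn i b
        rw [hx, h2]
        linarith

/-- Keep each index with probability `q`: the linear term scales by `q`, the off-diagonal one by `q
^ 2`, and some outcome is no worse than the mean. -/
lemma exists_subset_sampled (T : Finset ι) {q : ℝ} (hq0 : 0 ≤ q) (hq1 : q ≤ 1)
    (f : ι → ℝ) (g : ι → ι → ℝ) (hg : ∀ i, g i i = 0) :
    ∃ S ⊆ T, -(∑ i ∈ S, f i) + ∑ i ∈ S, ∑ j ∈ S, g i j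
      ≤ -(q * ∑ i ∈ T, f i) + q ^ 2 * ∑ i ∈ T, ∑ j ∈ T, g i j := by
  obtain ⟨S, hST, hS⟩ := exists_le_bernExp T hq0 hq1
    (fun S => -(∑ i ∈ S, f i) + ∑ i ∈ S, ∑ j ∈ S, g i j)
  refine ⟨S, hST, hS.trans (le_of_eq ?_)⟩
  have key : ∀ S ⊆ T, -(∑ i ∈ S, f i) + ∑ i ∈ S, ∑ j ∈ S, g i j
      = (∑ i ∈ T, -f i * if {i} ⊆ S then 1 else 0) +
        ∑ i ∈ T, ∑ j ∈ T, g i j * if {i, j} ⊆ S then 1 else 0 := by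
    intro S hS
    have e : ∀ F : ι → ℝ, ∑ i ∈ S, F i = ∑ i ∈ T, if i ∈ S then F i else 0 := fun F => by
      rw [← sum_filter, filter_mem_eq_inter, inter_eq_right.2 hS]
    rw [← sum_neg_distrib]
    congr 1
    · rw [e]
      exact sum_congr rfl fun i _ => by simp
    · rw [e]
      refine sum_congr rfl fun i _ => ?_
      split_ifs with hi
      · rw [e]
        exact sum_congr rfl fun j _ => by simp [insert_subset_iff, hi]
      · refine (sum_eq_zero fun j _ => ?_).symm
        simp [insert_subset_iff, hi]
  rw [bernExp_congr key, bernExp_add, bernExp_sum]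
  simp only [bernExp_sum, bernExp_const_mul]
  congr 1
  · rw [mul_sum, ← sum_neg_distrib]
    refine sum_congr rfl fun i hi => ?_
    rw [bernExp_subset (singleton_subset_iff.2 hi), card_singleton]
    ring
  · rw [mul_sum]
    refine sum_congr rfl fun i hi => ?_
    rw [mul_sum]
    refine sum_congr rfl fun j hj => ?_
    by_cases hij : i = j
    · subst hij; simp [hg]
    · rw [bernExp_subset (insert_subset_iff.2 ⟨hi, singleton_subset_iff.2 hj⟩), card_pair hij]
      ring

/-- Janson's inequality. -/
theorem avoidProb_le_exp_sq {Ω : Finset α} {p : ℝ} (hp0 : 0 ≤ p) (hp1 : p ≤ 1)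
    (A : ι → Finset α) (hA : ∀ i, A i ⊆ Ω) (T : Finset ι) {μ D : ℝ} (hD : 0 < D)
    (hμ0 : 0 ≤ μ) (hμ : μ = ∑ i ∈ T, p ^ #(A i)) (hμD : μ ≤ D)
    (hΔ : (∑ i ∈ T, ∑ j ∈ T,
      if j ≠ i ∧ ¬ Disjoint (A i) (A j) then p ^ #(A i ∪ A j) else 0) ≤ D) :
    avoidProb Ω p A T ≤ Real.exp (-(μ ^ 2 / (4 * D))) := by
  -- The sampling rate `μ / (2 * D)` minimises `-q * μ + q ^ 2 * D`, with minimum `-μ ^ 2 / (4 *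
  -- D)`.
  have hq0 : 0 ≤ μ / (2 * D) := by positivity
  have hq1 : μ / (2 * D) ≤ 1 := by rw [div_le_one (by positivity)]; linarith
  obtain ⟨S, hST, hS⟩ := exists_subset_sampled T hq0 hq1 (fun i => p ^ #(A i))
    (fun i j => if j ≠ i ∧ ¬ Disjoint (A i) (A j) then p ^ #(A i ∪ A j) else 0) (by simp)
  refine (avoidProb_anti hp0 hp1 A hST).trans ((avoidProb_le_exp hp0 hp1 A hA S).trans ?_)
  apply Real.exp_le_exp.2
  refine hS.trans ?_
  rw [← hμ]
  have h1 : (μ / (2 * D)) ^ 2 * (∑ i ∈ T, ∑ j ∈ T,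
      if j ≠ i ∧ ¬ Disjoint (A i) (A j) then p ^ #(A i ∪ A j) else 0) ≤ (μ / (2 * D)) ^ 2 * D :=
    mul_le_mul_of_nonneg_left hΔ (by positivity)
  have h2 : (μ / (2 * D)) ^ 2 * D = μ ^ 2 / (4 * D) := by field_simp; ring
  have h3 : μ / (2 * D) * μ = 2 * (μ ^ 2 / (4 * D)) := by field_simp; ring
  linarith

end BinomialSubset

/-! ### Lists spanning powers of tight paths, and how many edges they can share. -/

section PathPower

open Finset

variable {V : Type*} [DecidableEq V] {k h : ℕ} {E : Set (Finset V)}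

/-- Every `k`-element set of vertices of the list `l` that lies in `h + 1` consecutive entries
belongs to `E`. -/
def IsPathPower (k h : ℕ) (E : Set (Finset V)) : List V → Prop
  | [] => True
  | u :: l => IsPathPower k h E l ∧
      ∀ S ⊆ (l.take h).toFinset, u ∉ S → #S + 1 = k → insert u S ∈ E

lemma IsPathPower.mono {E' : Set (Finset V)} (hE : E ⊆ E') :
    ∀ {l : List V}, IsPathPower k h E l → IsPathPower k h E' l
  | [], _ => trivial
  | _ :: _, hl => ⟨hl.1.mono hE, fun S hS hu hc => hE (hl.2 S hS hu hc)⟩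

lemma IsPathPower.of_append_right :
    ∀ {x y : List V}, IsPathPower k h E (x ++ y) → IsPathPower k h E y
  | [], _, hl => hl
  | _ :: _, _, hl => IsPathPower.of_append_right hl.1

lemma IsPathPower.of_append_left :
    ∀ {x y : List V}, IsPathPower k h E (x ++ y) → IsPathPower k h E x
  | [], _, _ => trivial
  | u :: x, y, hl => by
    refine ⟨IsPathPower.of_append_left hl.1, fun S hS => hl.2 S (hS.trans ?_)⟩
    intro v hv
    rw [List.mem_toFinset] at hv ⊢
    change v ∈ (x ++ y).take h
    rw [List.take_append]
    exact List.mem_append_left _ hv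

/-- A vertex of `x` sees only the next `h` entries, and these already lie in `x ++ a`. -/
lemma IsPathPower.glue {a b : List V} (ha : h ≤ a.length) (hab : IsPathPower k h E (a ++ b)) :
    ∀ {x : List V}, IsPathPower k h E (x ++ a) → IsPathPower k h E (x ++ a ++ b)
  | [], _ => hab
  | u :: x, hx => by
    refine ⟨IsPathPower.glue ha hab hx.1, fun S hS => hx.2 S ?_⟩
    change S ⊆ ((x ++ a ++ b).take h).toFinset at hS
    rwa [List.take_append_of_le_length (by simp; omega)] at hS

lemma IsPathPower.cons {v : V} {z : List V} (hz : IsPathPower k h E z)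
    (hv : ∀ S ⊆ (z.take h).toFinset, #S = k - 1 → insert v S ∈ E) :
    IsPathPower k h E (v :: z) :=
  ⟨hz, fun S hS _ hc => hv S hS (by omega)⟩

/-- The definition looks forward from each vertex, so a vertex appended at the right matters only to
entries whose next `h` entries reach it. From such an entry on, the old list lies within its last
`h` entries, where the hypothesis on `v` applies. -/
lemma IsPathPower.concat {v : V} : ∀ {z : List V}, IsPathPower k h E z →
    (∀ S ⊆ (z.reverse.take h).toFinset, #S = k - 1 → insert v S ∈ E) →
    2 ≤ k → 1 ≤ h → IsPathPower k h E (z ++ [v])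
  | [], _, _, hk, _ => by
    refine ⟨trivial, fun S hS _ hc => ?_⟩
    have : S = ∅ := by simpa using hS
    subst this
    simp at hc
    omega
  | u :: z, hz, hv, hk, hh => by
    have hsub : (z.reverse.take h).toFinset ⊆ ((u :: z).reverse.take h).toFinset := by
      intro w hw
      rw [List.mem_toFinset] at hw ⊢
      rw [List.reverse_cons, List.take_append]
      exact List.mem_append_left _ hw
    refine ⟨IsPathPower.concat hz.1 (fun S hS => hv S (hS.trans hsub)) hk hh, ?_⟩
    intro S hS hu hc
    change S ⊆ ((z ++ [v]).take h).toFinset at hS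
    by_cases hlen : h ≤ z.length
    · rw [List.take_append_of_le_length hlen] at hS
      exact hz.2 S hS hu hc
    · have hz' : (u :: z).reverse.take h = (u :: z).reverse :=
        List.take_of_length_le (by simp; omega)
      have hzt : z.take h = z := List.take_of_length_le (by omega)
      rw [hz'] at hv
      by_cases hvS : v ∈ S
      · have h1 : insert u (S.erase v) ⊆ ((u :: z).reverse).toFinset := by
          intro w hw
          rw [mem_insert, mem_erase] at hw
          rw [List.mem_toFinset, List.mem_reverse, List.mem_cons]
          rcases hw with rfl | ⟨hw, hwS⟩
          · exact Or.inl rfl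
          · have := List.mem_of_mem_take (List.mem_toFinset.1 (hS hwS))
            rw [List.mem_append, List.mem_singleton] at this
            exact Or.inr (this.resolve_right hw)
        have h2 := hv _ h1 (by
          rw [card_insert_of_notMem (fun hh => hu (mem_of_mem_erase hh)),
            card_erase_of_mem hvS]
          have := card_pos.2 ⟨v, hvS⟩
          omega)
        rwa [insert_comm, insert_erase hvS] at h2
      · refine hz.2 S (fun w hw => ?_) hu hc
        have := List.mem_of_mem_take (List.mem_toFinset.1 (hS hw))
        rw [List.mem_append, List.mem_singleton] at this
        rw [hzt, List.mem_toFinset]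
        exact this.resolve_right fun hwv => hvS (hwv ▸ hw)

lemma IsPathPower.mem_of_subset_window : ∀ {l : List V} (i : ℕ), IsPathPower k h E l → 1 ≤ k →
    ∀ e : Finset V, e ⊆ ((l.drop i).take (h + 1)).toFinset → #e = k → e ∈ E
  | [], i, _, hk, e, he, hc => by
    have : e = ∅ := by simpa using he
    subst this
    simp at hc
    omega
  | u :: l, 0, hl, hk, e, he, hc => by
    simp only [List.drop_zero, List.take_succ_cons, List.toFinset_cons] at he
    by_cases hu : u ∈ e
    · have := hl.2 (e.erase u) (fun w hw => ?_) (notMem_erase _ _)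
        (by rw [card_erase_of_mem hu]; omega)
      · rwa [insert_erase hu] at this
      · rw [mem_erase] at hw
        exact (mem_insert.1 (he hw.2)).resolve_left hw.1
    · refine IsPathPower.mem_of_subset_window 0 hl.1 hk e (fun w hw => ?_) hc
      have := (mem_insert.1 (he hw)).resolve_left fun hwu => hu (hwu ▸ hw)
      rw [List.mem_toFinset] at this ⊢
      exact (List.take_sublist_take_left (Nat.le_succ h)).subset this
  | u :: l, i + 1, hl, hk, e, he, hc =>
    IsPathPower.mem_of_subset_window i hl.1 hk e he hc

lemma isPathPower_flatMap {T c : ℕ → List V} (N : ℕ) (hT : ∀ i ≤ N, h ≤ (T i).length)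
    (hc : ∀ i < N, h ≤ (c i).length) (hT0 : IsPathPower k h E (T 0))
    (h1 : ∀ i < N, IsPathPower k h E (T i ++ c i))
    (h2 : ∀ i < N, IsPathPower k h E (c i ++ T (i + 1))) :
    IsPathPower k h E ((List.range N).flatMap (fun i => T i ++ c i) ++ T N) := by
  induction N with
  | zero => simpa using hT0
  | succ N ih =>
    have ih := ih (fun i hi => hT i (by omega)) (fun i hi => hc i (by omega))
      (fun i hi => h1 i (by omega)) (fun i hi => h2 i (by omega))
    have h3 := IsPathPower.glue (hT N (by omega)) (h1 N (by omega)) ih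
    have h4 := IsPathPower.glue (hc N (by omega)) (h2 N (by omega)) h3
    rw [List.range_succ, List.flatMap_append]
    simpa using h4

/-- A cyclic window of `k + r - 1` vertices is an ordinary window of `l` followed by its own first
`k + r - 2` entries. -/
lemma IsPathPower.containsTightHamiltonCyclePower {k r : ℕ} (hk : 1 ≤ k) [Finite V]
    (G : KGraph k V) (l : List V) (hnd : l.Nodup) (hl : ∀ v, v ∈ l) (hlen : k + r - 1 ≤ l.length)
    (hr : 1 ≤ k + r - 1)
    (hpow : IsPathPower k (k + r - 2) G.edges (l ++ l.take (k + r - 2))) :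
    G.ContainsTightHamiltonCyclePower r := by
  have hcard : Nat.card V = l.length := by
    have := Fintype.ofFinite V
    rw [Nat.card_eq_fintype_card, ← card_univ, ← List.toFinset_card_of_nodup hnd]
    congr 1
    ext v
    simp [hl v]
  have hne : NeZero (Nat.card V) := ⟨by omega⟩
  have hlt : ∀ i : ZMod (Nat.card V), i.val < l.length := fun i => hcard ▸ ZMod.val_lt i
  let f : ZMod (Nat.card V) → V := fun i => l[i.val]'(hlt i)
  have hf : Function.Bijective f := by
    refine ⟨fun i j hij => ZMod.val_injective _ ((hnd.getElem_inj_iff).1 hij), fun v => ?_⟩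
    obtain ⟨i, hi, rfl⟩ := List.mem_iff_getElem.1 (hl v)
    refine ⟨(i : ZMod (Nat.card V)), ?_⟩
    simp only [f]
    congr 1
    exact ZMod.val_cast_of_lt (hcard ▸ hi)
  let v := Equiv.ofBijective f hf
  refine ⟨⟨{e | #e = k ∧ ∃ i, e ⊆ KGraph.window v (k + r - 1) i}, fun e he => he.1⟩, ?_,
    by omega, v, fun e => Iff.rfl⟩
  rintro e ⟨hek, i, hei⟩
  refine hpow.mem_of_subset_window i.val hk e (hei.trans ?_) hek
  intro w hw
  rw [KGraph.window, mem_image] at hw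
  obtain ⟨j, hj, rfl⟩ := hw
  rw [mem_range] at hj
  rw [List.mem_toFinset, List.mem_take_iff_getElem]
  have hi := hlt i
  refine ⟨j, by simp; omega, ?_⟩
  rw [List.getElem_drop]
  have hval : (i + (j : ZMod (Nat.card V))).val = (i.val + j) % l.length := by
    rw [ZMod.val_add, ZMod.val_natCast, Nat.add_mod_mod, ← hcard]
  change _ = l[(i + (j : ZMod (Nat.card V))).val]'(hlt _)
  by_cases hij : i.val + j < l.length
  · rw [List.getElem_append_left hij]
    congr 1
    rw [hval, Nat.mod_eq_of_lt hij]
  · rw [List.getElem_append_right (by omega), List.getElem_take]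
    congr 1
    rw [hval, Nat.mod_eq_sub_mod (by omega), Nat.mod_eq_of_lt (by omega)]

/-- The `k`-element sets of vertices lying in `h + 1` consecutive entries of a list. -/
def powEdges (k h : ℕ) : List V → Finset (Finset V)
  | [] => ∅
  | u :: l => powEdges k h l ∪
      ((powersetCard (k - 1) (l.take h).toFinset).filter (u ∉ ·)).image (insert u)

lemma isPathPower_iff_powEdges (hk : 1 ≤ k) :
    ∀ l : List V, IsPathPower k h E l ↔ (powEdges k h l : Set (Finset V)) ⊆ E
  | [] => by simp [IsPathPower, powEdges]
  | u :: l => by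
    rw [IsPathPower, powEdges, isPathPower_iff_powEdges hk l, coe_union, Set.union_subset_iff]
    refine and_congr_right fun _ => ?_
    rw [coe_image, Set.image_subset_iff]
    constructor
    · intro hS S hS'
      rw [mem_coe, mem_filter, mem_powersetCard] at hS'
      exact hS S hS'.1.1 hS'.2 (by omega)
    · intro hS S h1 h2 h3
      exact hS (mem_coe.2 (mem_filter.2 ⟨mem_powersetCard.2 ⟨h1, by omega⟩, h2⟩))

lemma card_of_mem_powEdges (hk : 1 ≤ k) : ∀ {l : List V}, ∀ e ∈ powEdges k h l, #e = k
  | [], e, he => by simp [powEdges] at he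
  | u :: l, e, he => by
    rw [powEdges, mem_union] at he
    rcases he with he | he
    · exact card_of_mem_powEdges hk e he
    · simp only [mem_image, mem_filter, mem_powersetCard] at he
      obtain ⟨S, ⟨⟨h1, h2⟩, h3⟩, rfl⟩ := he
      rw [card_insert_of_notMem h3]
      omega

lemma subset_of_mem_powEdges : ∀ {l : List V}, ∀ e ∈ powEdges k h l, e ⊆ l.toFinset
  | [], e, he => by simp [powEdges] at he
  | u :: l, e, he => by
    rw [powEdges, mem_union] at he
    rw [List.toFinset_cons]
    rcases he with he | he
    · exact (subset_of_mem_powEdges e he).trans (subset_insert _ _)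
    · simp only [mem_image, mem_filter, mem_powersetCard] at he
      obtain ⟨S, ⟨⟨h1, h2⟩, h3⟩, rfl⟩ := he
      refine insert_subset_insert _ (h1.trans fun w hw => ?_)
      rw [List.mem_toFinset] at hw ⊢
      exact List.mem_of_mem_take hw

lemma powEdges_map {W : Type*} [DecidableEq W] {f : V → W} (hf : Function.Injective f) :
    ∀ l : List V, powEdges k h (l.map f) = (powEdges k h l).image (image f)
  | [] => by simp [powEdges]
  | u :: l => by
    rw [List.map_cons, powEdges, powEdges, image_union, powEdges_map hf l]
    congr 1
    have h1 : ((l.map f).take h).toFinset = (l.take h).toFinset.image f := by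
      rw [← List.map_take]
      ext; simp [-List.map_take]
    ext e
    simp only [h1, mem_image, mem_filter, mem_powersetCard]
    constructor
    · rintro ⟨S, ⟨⟨hS, hc⟩, hu⟩, rfl⟩
      obtain ⟨S', hS', rfl⟩ := subset_image_iff.1 hS
      refine ⟨insert u S', ⟨S', ⟨⟨hS', by rwa [card_image_of_injective _ hf] at hc⟩, ?_⟩, rfl⟩,
        image_insert _ _ _⟩
      exact fun hh => hu (mem_image_of_mem f hh)
    · rintro ⟨e, ⟨S, ⟨⟨hS, hc⟩, hu⟩, rfl⟩, rfl⟩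
      refine ⟨S.image f, ⟨⟨image_subset_image hS, by rwa [card_image_of_injective _ hf]⟩, ?_⟩,
        (image_insert _ _ _).symm⟩
      rwa [hf.mem_finset_image]

lemma card_powEdges_ofFn {s : ℕ} {t : Fin s → V} (ht : Function.Injective t) :
    #(powEdges k h (List.ofFn t)) = #(powEdges k h (List.finRange s)) := by
  rw [List.ofFn_eq_map, powEdges_map ht, card_image_of_injective _ (image_injective ht)]

/-- Sort the edges inside `W` by their first vertex in `l`. If `j` further vertices of `W` follow
it, it starts at most `(min j h).choose (k - 1)` of them. -/
lemma card_powEdges_subset_le (W : Finset V) : ∀ {l : List V}, l.Nodup →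
    #((powEdges k h l).filter (· ⊆ W)) ≤
      ∑ j ∈ range #(W ∩ l.toFinset), (min j h).choose (k - 1)
  | [], _ => by simp [powEdges]
  | u :: l, hl => by
    rw [List.nodup_cons] at hl
    have ih := card_powEdges_subset_le W hl.2
    rw [powEdges, filter_union, List.toFinset_cons]
    refine (card_union_le _ _).trans ?_
    by_cases hu : u ∈ W
    · have hul : u ∉ W ∩ l.toFinset := fun hh => hl.1 (List.mem_toFinset.1 (mem_inter.1 hh).2)
      rw [inter_insert_of_mem hu, card_insert_of_notMem hul, sum_range_succ]
      refine Nat.add_le_add ih ?_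
      have hsub : (((powersetCard (k - 1) (l.take h).toFinset).filter (u ∉ ·)).image
          (insert u)).filter (· ⊆ W) ⊆
          (powersetCard (k - 1) (W ∩ (l.take h).toFinset)).image (insert u) := by
        intro e he
        simp only [mem_filter, mem_image, mem_powersetCard] at he ⊢
        obtain ⟨⟨S, ⟨⟨hS, hc⟩, _⟩, rfl⟩, hW⟩ := he
        exact ⟨S, ⟨subset_inter ((subset_insert _ _).trans hW) hS, hc⟩, rfl⟩
      refine (card_le_card hsub).trans (card_image_le.trans ?_)
      rw [card_powersetCard]
      refine Nat.choose_le_choose _ (le_min (card_le_card ?_) ?_)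
      · refine inter_subset_inter_left fun w hw => ?_
        rw [List.mem_toFinset] at hw ⊢
        exact List.mem_of_mem_take hw
      · refine (card_le_card inter_subset_right).trans ((List.toFinset_card_le _).trans ?_)
        simp
    · rw [inter_insert_of_notMem hu]
      refine (Nat.add_le_add_left (Nat.le_of_eq ?_) _).trans ((add_zero _).trans_le ih)
      rw [card_eq_zero, filter_eq_empty_iff]
      intro e he heW
      simp only [mem_image, mem_filter] at he
      obtain ⟨S, _, rfl⟩ := he
      exact hu (heW (mem_insert_self _ _))

/-- The surplus of one is what allows `p` to drop below `n ^ (-1 / C)`. It is gained at `w = 2`,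
where `2 ≤ h` is essential: for `k = 2` there is one edge against `C = h`, and for larger `k` none
against `C ≥ 1`. Each further vertex adds at most `C`. -/
lemma sum_choose_min_lt {k h : ℕ} (hk : 2 ≤ k) (hkh : k ≤ h + 1) (hh : 2 ≤ h) {w : ℕ}
    (hw : 2 ≤ w) : ∑ j ∈ range w, (min j h).choose (k - 1) + 1 ≤ h.choose (k - 1) * (w - 1) := by
  induction w, hw using Nat.le_induction with
  | base =>
    have h1 : min 1 h = 1 := by omega
    have hC : 0 < h.choose (k - 1) := Nat.choose_pos (by omega)
    rcases Nat.eq_or_lt_of_le hk with rfl | hk3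
    · simp [sum_range_succ, h1]; omega
    · rw [sum_range_succ, sum_range_one, h1, Nat.choose_eq_zero_of_lt (by omega),
        Nat.choose_eq_zero_of_lt (by omega)]
      omega
  | succ w hw ih =>
    have h1 : (min w h).choose (k - 1) ≤ h.choose (k - 1) :=
      Nat.choose_le_choose _ (min_le_right _ _)
    rw [sum_range_succ]
    obtain ⟨w, rfl⟩ : ∃ w', w = w' + 1 := ⟨w - 1, by omega⟩
    simp only [Nat.add_sub_cancel] at ih ⊢
    rw [Nat.mul_succ]
    omega

/-- Shared edges lie within the common vertices, so it suffices to count the edges of one path power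
there. -/
lemma card_inter_powEdges_lt {s : ℕ} (hk : 2 ≤ k) (hkh : k ≤ h + 1) (hh : 2 ≤ h)
    {t t' : Fin s → V} (ht' : Function.Injective t')
    (hne : ¬ Disjoint (powEdges k h (List.ofFn t)) (powEdges k h (List.ofFn t'))) :
    #(powEdges k h (List.ofFn t) ∩ powEdges k h (List.ofFn t')) + 1
      ≤ h.choose (k - 1) * (#{i | t' i ∈ univ.image t} - 1) := by
  have hw : #(univ.image t ∩ (List.ofFn t').toFinset) = #{i | t' i ∈ univ.image t} := by
    rw [← card_image_of_injective _ ht']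
    congr 1
    ext v
    simp only [mem_inter, mem_image, mem_univ, true_and, List.mem_toFinset, List.mem_ofFn,
      mem_filter]
    constructor
    · rintro ⟨⟨i, rfl⟩, ⟨j, hj⟩⟩
      exact ⟨j, ⟨i, hj.symm⟩, hj⟩
    · rintro ⟨j, ⟨i, hi⟩, rfl⟩
      exact ⟨⟨i, hi⟩, ⟨j, rfl⟩⟩
  have hsub : powEdges k h (List.ofFn t) ∩ powEdges k h (List.ofFn t') ⊆
      (powEdges k h (List.ofFn t')).filter (· ⊆ univ.image t) := by
    intro e he
    rw [mem_inter] at he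
    refine mem_filter.2 ⟨he.2, (subset_of_mem_powEdges e he.1).trans ?_⟩
    intro v hv
    simpa [List.mem_ofFn] using hv
  have h1 := (card_le_card hsub).trans
    (card_powEdges_subset_le (univ.image t) (List.nodup_ofFn.2 ht'))
  rw [hw] at h1
  have h2 : 2 ≤ #{i | t' i ∈ univ.image t} := by
    rw [← hw]
    obtain ⟨e, he⟩ := not_disjoint_iff_nonempty_inter.1 hne
    have h3 := mem_filter.1 (hsub he)
    calc 2 ≤ k := hk
      _ = #e := (card_of_mem_powEdges (by omega) e h3.1).symm
      _ ≤ _ := card_le_card (subset_inter h3.2 (subset_of_mem_powEdges e h3.1))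
  exact (Nat.add_le_add_right h1 1).trans (sum_choose_min_lt hk hkh hh h2)

end PathPower

/-! ### With high probability the random graph hits every dense family. -/

section Hitting

open Finset

/-- The power of `n` is a product over coordinates, so the sum factorises, each factor being at most
`s * n + n`. -/
lemma sum_pow_card_image_le {s n : ℕ} (t : Fin s → Fin n) (hn : 1 ≤ n) :
    ∑ t' : Fin s → Fin n, (n : ℝ) ^ #{i | t' i ∈ univ.image t} ≤ ((s + 1) * n) ^ s := by
  have h1 : ∀ t' : Fin s → Fin n, (n : ℝ) ^ #{i | t' i ∈ univ.image t}
      = ∏ i, if t' i ∈ univ.image t then (n : ℝ) else 1 := fun t' => by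
    rw [prod_ite, prod_const, prod_const_one, mul_one]
  simp only [h1]
  have h2 := prod_univ_sum (fun _ : Fin s => (univ : Finset (Fin n)))
    (fun _ v => if v ∈ univ.image t then (n : ℝ) else 1)
  rw [Fintype.piFinset_univ] at h2
  rw [← h2, prod_const, card_univ, Fintype.card_fin]
  have hn' : (1 : ℝ) ≤ n := by exact_mod_cast hn
  refine pow_le_pow_left₀ (sum_nonneg fun v _ => by split_ifs <;> linarith) ?_ _
  rw [sum_ite, sum_const, sum_const, nsmul_eq_mul, nsmul_eq_mul, mul_one, add_mul, one_mul]
  refine add_le_add (mul_le_mul_of_nonneg_right ?_ (by linarith)) ?_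
  · have : #(univ.filter (· ∈ univ.image t)) ≤ s := by
      rw [filter_mem_eq_inter, univ_inter]
      exact card_image_le.trans (by simp)
    exact_mod_cast this
  · have : #(univ.filter (· ∉ univ.image t)) ≤ n := (card_le_univ _).trans (by simp)
    exact_mod_cast this

/-- The spare edge lowers the exponent by `1 / C`. Half of this covers the loss `ε * C * (w - 1)`,
and the other half is kept. -/
lemma overlap_exponent_le {C w j s : ℕ} {ε : ℝ} (hC : 1 ≤ C) (hε : 0 ≤ ε)
    (hεs : ε * C * s ≤ 1 / (2 * C)) (hw1 : 1 ≤ w) (hws : w ≤ s) (hj : j + 1 ≤ C * (w - 1)) :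
    ((C : ℝ)⁻¹ + ε) * j ≤ w - 1 - 1 / (2 * C) := by
  have hC' : (1 : ℝ) ≤ C := by exact_mod_cast hC
  have hCpos : (0 : ℝ) < C := by linarith
  have hj' : (j : ℝ) ≤ C * (w - 1) - 1 := by
    have : ((j + 1 : ℕ) : ℝ) ≤ ((C * (w - 1) : ℕ) : ℝ) := by exact_mod_cast hj
    push_cast [Nat.cast_sub hw1] at this
    linarith
  have h1 : ((C : ℝ)⁻¹ + ε) * j ≤ ((C : ℝ)⁻¹ + ε) * (C * (w - 1) - 1) :=
    mul_le_mul_of_nonneg_left hj' (by positivity)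
  have h2 : ((C : ℝ)⁻¹ + ε) * (C * (w - 1) - 1)
      = w - 1 - 2 * (1 / (2 * C)) + ε * C * (w - 1) - ε := by
    field_simp
    ring
  have h3 : ε * C * (w - 1) ≤ ε * C * s := by
    refine mul_le_mul_of_nonneg_left ?_ (by positivity)
    have : (w : ℝ) ≤ s := by exact_mod_cast hws
    linarith
  linarith

/-- A dense family of injective tuples contains, up to super-exponentially small failure
probability, one which spans a path power in the random `k`-graph. -/
lemma avoidProb_powEdges_le {k h s n : ℕ} (hk : 2 ≤ k) (hkh : k ≤ h + 1) (hh : 2 ≤ h)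
    {ε c p : ℝ} (hε : 0 ≤ ε)
    (hεs : ε * (h.choose (k - 1) : ℝ) * s ≤ 1 / (2 * (h.choose (k - 1) : ℝ)))
    (hc : 0 < c) (hn : 1 ≤ n) (hp1 : p ≤ 1)
    (hp : (n : ℝ) ^ (-(h.choose (k - 1) : ℝ)⁻¹ - ε) ≤ p) (T : Finset (Fin s → Fin n))
    (hT : ∀ t ∈ T, Function.Injective t) (hcT : c * (n : ℝ) ^ s ≤ #T) :
    avoidProb (powersetCard k univ) p (fun t : Fin s → Fin n => powEdges k h (List.ofFn t)) T
      ≤ Real.exp (-(c / (4 * (s + 1 : ℝ) ^ s) *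
          (n : ℝ) ^ (1 + 1 / (2 * (h.choose (k - 1) : ℝ))))) := by
  set C := h.choose (k - 1) with hCdef
  have hC : 1 ≤ C := Nat.choose_pos (by omega)
  set δ : ℝ := 1 / (2 * (C : ℝ)) with hδ
  set A : (Fin s → Fin n) → Finset (Finset (Fin n)) :=
    fun t => powEdges k h (List.ofFn t) with hA
  set e := #(powEdges k h (List.finRange s)) with he
  have hn' : (1 : ℝ) ≤ n := by exact_mod_cast hn
  have hn0 : (0 : ℝ) < n := by linarith
  have hp0 : 0 < p := lt_of_lt_of_le (Real.rpow_pos_of_pos hn0 _) hp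
  have hTpos : (0 : ℝ) < #T := lt_of_lt_of_le (by positivity) hcT
  have hAe : ∀ t ∈ T, #(A t) = e := fun t ht => card_powEdges_ofFn (hT t ht)
  -- If there are no edges at all, the family is hit with certainty. Below, `A t` must meet itself
  -- so that diagonal terms count.
  rcases Nat.eq_zero_or_pos e with he0 | hepos
  · have hne : T.Nonempty := card_pos.1 (by exact_mod_cast hTpos)
    obtain ⟨t, ht⟩ := hne
    have : avoidProb (powersetCard k univ) p A T = 0 := by
      rw [avoidProb, bernExp_congr (g' := fun _ => 0 * 1), bernExp_const_mul, zero_mul]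
      intro ω _
      rw [if_neg, zero_mul]
      intro hω
      refine hω t ht ?_
      rw [card_eq_zero.1 ((hAe t ht).trans he0)]
      exact empty_subset _
    rw [this]
    exact (Real.exp_pos _).le
  -- A bound for the row of each `t` in the correlation sum. With `D = #T * X`, the ratio `μ ^ 2 /
  -- D` is of order `n ^ (1 + δ)`.
  set X : ℝ := p ^ (2 * e) * (n : ℝ) ^ (-1 - δ) * ((s + 1) * n) ^ s with hX
  have hXpos : 0 < X := by positivity
  have hpair : ∀ t ∈ T, ∀ t' ∈ T, ¬ Disjoint (A t) (A t') →
      p ^ #(A t ∪ A t') ≤ p ^ (2 * e) * (n : ℝ) ^ (-1 - δ) *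
        (n : ℝ) ^ #{i | t' i ∈ univ.image t} := by
    intro t ht t' ht' hd
    have hlt := card_inter_powEdges_lt hk hkh hh (hT t' ht') hd
    change #(A t ∩ A t') + 1 ≤ C * _ at hlt
    set w := #{i | t' i ∈ univ.image t} with hw
    set j := #(A t ∩ A t') with hj
    have hw1 : 1 ≤ w := by
      by_contra hw0
      have : w = 0 := by omega
      rw [this] at hlt
      simp at hlt
    have hws : w ≤ s := (card_le_univ _).trans (by simp)
    have hexp := overlap_exponent_le hC hε hεs hw1 hws hlt
    have hcard : #(A t ∪ A t') + j = 2 * e := by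
      rw [hj, card_union_add_card_inter, hAe t ht, hAe t' ht', two_mul]
    have h1 : p⁻¹ ≤ (n : ℝ) ^ ((C : ℝ)⁻¹ + ε) := by
      rw [inv_le_comm₀ hp0 (by positivity), ← Real.rpow_neg hn0.le]
      refine le_trans (le_of_eq ?_) hp
      congr 1
      ring
    have h2 : (p⁻¹) ^ j ≤ (n : ℝ) ^ ((w : ℝ) - 1 - δ) := by
      calc (p⁻¹) ^ j ≤ ((n : ℝ) ^ ((C : ℝ)⁻¹ + ε)) ^ j :=
            pow_le_pow_left₀ (by positivity) h1 _
        _ = (n : ℝ) ^ (((C : ℝ)⁻¹ + ε) * j) := by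
            rw [Real.rpow_mul hn0.le, Real.rpow_natCast]
        _ ≤ _ := Real.rpow_le_rpow_of_exponent_le hn' hexp
    have h3 : p ^ #(A t ∪ A t') = p ^ (2 * e) * (p⁻¹) ^ j := by
      rw [← hcard, pow_add, mul_assoc, ← mul_pow, mul_inv_cancel₀ hp0.ne', one_pow, mul_one]
    rw [h3, mul_assoc]
    refine mul_le_mul_of_nonneg_left (h2.trans (le_of_eq ?_)) (by positivity)
    rw [← Real.rpow_natCast, ← Real.rpow_add hn0]
    congr 1
    ring
  have hrow : ∀ t ∈ T, (∑ t' ∈ T, if ¬ Disjoint (A t) (A t') then p ^ #(A t ∪ A t') else 0)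
      ≤ X := by
    intro t ht
    calc (∑ t' ∈ T, if ¬ Disjoint (A t) (A t') then p ^ #(A t ∪ A t') else 0)
        ≤ ∑ t' ∈ T, p ^ (2 * e) * (n : ℝ) ^ (-1 - δ) * (n : ℝ) ^ #{i | t' i ∈ univ.image t} :=
          sum_le_sum fun t' ht' => by
            split_ifs with hd
            · positivity
            · exact hpair t ht t' ht' hd
      _ ≤ ∑ t' : Fin s → Fin n,
            p ^ (2 * e) * (n : ℝ) ^ (-1 - δ) * (n : ℝ) ^ #{i | t' i ∈ univ.image t} :=
          sum_le_univ_sum_of_nonneg fun t' => by positivity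
      _ ≤ X := by
          rw [← mul_sum]
          exact mul_le_mul_of_nonneg_left (sum_pow_card_image_le t hn) (by positivity)
  have hD : (∑ t ∈ T, ∑ t' ∈ T, if ¬ Disjoint (A t) (A t') then p ^ #(A t ∪ A t') else 0)
      ≤ #T * X := (sum_le_sum hrow).trans (by rw [sum_const, nsmul_eq_mul])
  have hμ : (#T : ℝ) * p ^ e = ∑ t ∈ T, p ^ #(A t) := by
    rw [sum_congr rfl fun t ht => by rw [hAe t ht], sum_const, nsmul_eq_mul]
  -- The diagonal of the correlation sum alone is `μ`.
  have hμD : (#T : ℝ) * p ^ e ≤ #T * X := by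
    refine le_trans ?_ hD
    rw [hμ]
    refine sum_le_sum fun t ht => ?_
    have h1 : p ^ #(A t) = if ¬ Disjoint (A t) (A t) then p ^ #(A t ∪ A t) else 0 := by
      rw [if_pos, union_self]
      rw [disjoint_self_iff_empty, ← card_eq_zero, hAe t ht]
      omega
    rw [h1]
    exact single_le_sum (f := fun t' => if ¬ Disjoint (A t) (A t') then p ^ #(A t ∪ A t') else 0)
      (fun t' _ => by split_ifs <;> positivity) ht
  have hΔ : (∑ t ∈ T, ∑ t' ∈ T,
      if t' ≠ t ∧ ¬ Disjoint (A t) (A t') then p ^ #(A t ∪ A t') else 0) ≤ #T * X := by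
    refine le_trans (sum_le_sum fun t _ => sum_le_sum fun t' _ => ?_) hD
    by_cases h1 : Disjoint (A t) (A t')
    · simp [h1]
    · by_cases h2 : t' = t
      · simp only [h2]
        split_ifs <;> first | positivity | simp_all
      · simp [h1, h2]
  have hΩ : ∀ t : Fin s → Fin n, A t ⊆ powersetCard k univ := fun t x hx =>
    mem_powersetCard.2 ⟨subset_univ _, card_of_mem_powEdges (by omega) x hx⟩
  refine (avoidProb_le_exp_sq hp0.le hp1 A hΩ T (by positivity) (by positivity) hμ hμD hΔ).trans ?_
  apply Real.exp_le_exp.2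
  rw [neg_le_neg_iff]
  have h1 : ((#T : ℝ) * p ^ e) ^ 2 / (4 * (#T * X))
      = #T / (n : ℝ) ^ s * (n : ℝ) ^ (1 + δ) / (4 * (s + 1 : ℝ) ^ s) := by
    have h2 : (n : ℝ) ^ (-1 - δ) = ((n : ℝ) ^ (1 + δ))⁻¹ := by
      rw [← Real.rpow_neg hn0.le]; congr 1; ring
    rw [hX, h2, mul_pow, mul_pow]
    have : (0 : ℝ) < (n : ℝ) ^ (1 + δ) := by positivity
    field_simp
    rw [← pow_mul, mul_comm]
  rw [h1, div_mul_eq_mul_div]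
  refine div_le_div_of_nonneg_right (mul_le_mul_of_nonneg_right ?_ (by positivity))
    (by positivity)
  rwa [le_div_iff₀ (by positivity)]

lemma setBernoulli_real_le_bernExp {α : Type*} [Finite α] [DecidableEq α] (Ω : Finset α)
    (p : unitInterval) (S : Set (Set α)) (g : Finset α → ℝ)
    (hg0 : ∀ ω ⊆ Ω, 0 ≤ g ω) (hg : ∀ ω ⊆ Ω, (ω : Set α) ∈ S → 1 ≤ g ω) :
    (ProbabilityTheory.setBernoulli (Ω : Set α) p).real S ≤ bernExp Ω p g := by
  classical
  have hp0 : (0 : ℝ) ≤ p := p.2.1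
  have hp1 : (p : ℝ) ≤ 1 := p.2.2
  have h1 : (ProbabilityTheory.setBernoulli (Ω : Set α) p).real S
      = (ProbabilityTheory.setBernoulli (Ω : Set α) p).real {s ∈ S | s ⊆ Ω} := by
    rw [measureReal_def, ProbabilityTheory.setBernoulli_apply_eq_apply_subsets, measureReal_def]
  have h2 : {s ∈ S | s ⊆ (Ω : Set α)} ⊆
      ⋃ ω ∈ Ω.powerset.filter (fun ω : Finset α => (ω : Set α) ∈ S), {(ω : Set α)} := by
    rintro s ⟨hs, hsΩ⟩
    obtain ⟨ω, rfl⟩ := Set.Finite.exists_finset_coe (Set.toFinite s)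
    simp only [Set.mem_iUnion, mem_filter, mem_powerset]
    exact ⟨ω, ⟨by exact_mod_cast hsΩ, hs⟩, rfl⟩
  rw [h1]
  refine (measureReal_mono h2 (measure_ne_top _ _)).trans ((measureReal_biUnion_finset_le _ _).trans ?_)
  rw [sum_filter, bernExp]
  refine sum_le_sum fun ω hω => ?_
  have hωΩ := mem_powerset.1 hω
  have hw : 0 ≤ (p : ℝ) ^ #ω * (1 - p : ℝ) ^ #(Ω \ ω) :=
    mul_nonneg (pow_nonneg hp0 _) (pow_nonneg (by linarith) _)
  split_ifs with hS
  · rw [ProbabilityTheory.setBernoulli_real_singleton p (by exact_mod_cast hωΩ)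
      (Set.toFinite _), Set.ncard_coe_finset, ← coe_sdiff, Set.ncard_coe_finset]
    exact le_mul_of_one_le_right hw (hg ω hωΩ hS)
  · exact mul_nonneg hw (hg0 ω hωΩ)

lemma binomialRandom_real_avoid_le {k h s n : ℕ} (hk : 1 ≤ k) (p : unitInterval)
    (T : Finset (Fin s → Fin n)) :
    (KGraph.binomialRandom k (Fin n) p).real
        {G | ∀ t ∈ T, ¬ IsPathPower k h G.edges (List.ofFn t)} ≤
      avoidProb (powersetCard k univ) p
        (fun t : Fin s → Fin n => powEdges k h (List.ofFn t)) T := by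
  have hΩ : ({e : Finset (Fin n) | #e = k} : Set (Finset (Fin n)))
      = ((powersetCard k univ : Finset (Finset (Fin n))) : Set (Finset (Fin n))) := by
    ext e
    simp [mem_powersetCard]
  rw [KGraph.binomialRandom, measureReal_def,
    Measure.map_apply Measurable.of_discrete (MeasurableSpace.measurableSet_top), hΩ,
    ← measureReal_def]
  refine setBernoulli_real_le_bernExp _ _ _ _ (fun ω _ => by split_ifs <;> norm_num) ?_
  intro ω hω hS
  rw [if_pos]
  intro t ht hsub
  refine hS t ht ((isPathPower_iff_powEdges hk _).2 fun e he => ?_)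
  exact ⟨mem_coe.2 (hsub he), card_of_mem_powEdges hk e he⟩

/-- The factor `log (n + 1)` in the exponent is at most a constant times `n ^ (δ / 2)`, which is
beaten by `n ^ δ`. -/
lemma tendsto_pow_mul_exp_neg_rpow {c δ : ℝ} (hc : 0 < c) (hδ : 0 < δ) (B : ℕ) :
    Tendsto (fun n : ℕ => ((n : ℝ) + 1) ^ (B * n) * Real.exp (-(c * (n : ℝ) ^ (1 + δ))))
      atTop (𝓝 0) := by
  have hlim : Tendsto (fun n : ℕ => Real.exp (-(c / 2 * (n : ℝ)))) atTop (𝓝 0) :=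
    Real.tendsto_exp_neg_atTop_nhds_zero.comp
      (tendsto_natCast_atTop_atTop.const_mul_atTop (by positivity))
  have hbig : ∀ᶠ n : ℕ in atTop, 2 * (B * (2 ^ (δ / 2) / (δ / 2))) / c ≤ (n : ℝ) ^ (δ / 2) :=
    ((tendsto_rpow_atTop (by positivity)).comp tendsto_natCast_atTop_atTop).eventually_ge_atTop _
  refine squeeze_zero' (Eventually.of_forall fun n => by positivity) ?_ hlim
  filter_upwards [hbig, eventually_ge_atTop 1] with n hn hn1
  have hn' : (1 : ℝ) ≤ n := by exact_mod_cast hn1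
  have hn0 : (0 : ℝ) < n := by linarith
  have h1 : ((n : ℝ) + 1) ^ (B * n) = Real.exp (B * n * Real.log (n + 1)) := by
    rw [← Real.exp_log (show (0 : ℝ) < n + 1 by positivity), ← Real.exp_nat_mul]
    push_cast
    rw [Real.log_exp]
  rw [h1, ← Real.exp_add]
  apply Real.exp_le_exp.2
  have h2 : Real.log (n + 1) ≤ 2 ^ (δ / 2) / (δ / 2) * (n : ℝ) ^ (δ / 2) := by
    refine (Real.log_le_rpow_div (by positivity) (half_pos hδ)).trans ?_
    rw [div_mul_eq_mul_div, ← Real.mul_rpow (by norm_num) hn0.le]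
    refine div_le_div_of_nonneg_right (Real.rpow_le_rpow (by positivity) (by linarith)
      (by positivity)) (by positivity)
  have h3 : (n : ℝ) ^ (1 + δ) = n * (n : ℝ) ^ (δ / 2) * (n : ℝ) ^ (δ / 2) := by
    rw [mul_assoc, ← Real.rpow_add hn0, add_halves, Real.rpow_add hn0, Real.rpow_one]
  have h4 : B * n * Real.log (n + 1) ≤
      B * n * (2 ^ (δ / 2) / (δ / 2) * (n : ℝ) ^ (δ / 2)) :=
    mul_le_mul_of_nonneg_left h2 (by positivity)
  have h5 : 2 * (B * (2 ^ (δ / 2) / (δ / 2))) ≤ (n : ℝ) ^ (δ / 2) * c := by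
    rwa [div_le_iff₀ hc] at hn
  have h6 : (1 : ℝ) ≤ (n : ℝ) ^ (δ / 2) := Real.one_le_rpow hn' (by positivity)
  have h7 : B * (2 ^ (δ / 2) / (δ / 2)) * (n * (n : ℝ) ^ (δ / 2)) ≤
      (n : ℝ) ^ (δ / 2) * c / 2 * (n * (n : ℝ) ^ (δ / 2)) :=
    mul_le_mul_of_nonneg_right (by linarith) (by positivity)
  have h8 : c / 2 * n ≤ c / 2 * (n * (n : ℝ) ^ (δ / 2) * (n : ℝ) ^ (δ / 2)) := by
    refine mul_le_mul_of_nonneg_left ?_ (by positivity)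
    rw [mul_assoc]
    exact le_mul_of_one_le_right hn0.le (one_le_mul_of_one_le_of_one_le h6 h6)
  rw [h3]
  linarith

/-- With high probability, each dense member of a collection of at most `(n + 1) ^ (B * n)`
families of injective `s`-tuples contains a tuple spanning a path power in the random
`k`-graph. -/
theorem tendsto_binomialRandom_not_hit {k h s : ℕ} (hk : 2 ≤ k) (hkh : k ≤ h + 1) (hh : 2 ≤ h)
    {ε c : ℝ} (hε : 0 ≤ ε)
    (hεs : ε * (h.choose (k - 1) : ℝ) * s ≤ 1 / (2 * (h.choose (k - 1) : ℝ)))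
    (hc : 0 < c) (B : ℕ) (p : ℕ → unitInterval)
    (hp : ∀ᶠ n : ℕ in atTop, (n : ℝ) ^ (-(h.choose (k - 1) : ℝ)⁻¹ - ε) ≤ (p n : ℝ))
    {ι : ℕ → Type} [∀ n, Fintype (ι n)]
    (hι : ∀ n, 1 ≤ n → Fintype.card (ι n) ≤ (n + 1) ^ (B * n))
    (F : ∀ n, ι n → Finset (Fin s → Fin n))
    (hF : ∀ n i, ∀ t ∈ F n i, Function.Injective t) :
    Tendsto (fun n : ℕ => (KGraph.binomialRandom k (Fin n) (p n)).real
      {G | ¬ ∀ i, c * (n : ℝ) ^ s ≤ #(F n i) →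
        ∃ t ∈ F n i, IsPathPower k h G.edges (List.ofFn t)}) atTop (𝓝 0) := by
  classical
  have hC : 1 ≤ h.choose (k - 1) := Nat.choose_pos (by omega)
  have hC' : (0 : ℝ) < h.choose (k - 1) := by exact_mod_cast hC
  have hlim := tendsto_pow_mul_exp_neg_rpow (c := c / (4 * (s + 1 : ℝ) ^ s))
    (δ := 1 / (2 * (h.choose (k - 1) : ℝ))) (by positivity) (by positivity) B
  refine squeeze_zero' (Eventually.of_forall fun n => measureReal_nonneg) ?_ hlim
  filter_upwards [hp, eventually_ge_atTop 1] with n hpn hn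
  have hsub : {G : KGraph k (Fin n) | ¬ ∀ i, c * (n : ℝ) ^ s ≤ #(F n i) →
      ∃ t ∈ F n i, IsPathPower k h G.edges (List.ofFn t)} ⊆
      ⋃ i ∈ (univ : Finset (ι n)).filter (fun i => c * (n : ℝ) ^ s ≤ #(F n i)),
        {G | ∀ t ∈ F n i, ¬ IsPathPower k h G.edges (List.ofFn t)} := by
    intro G hG
    rw [Set.mem_ofPred_eq] at hG
    push Not at hG
    obtain ⟨i, hi, hG⟩ := hG
    simp only [Set.mem_iUnion, mem_filter, mem_univ, true_and]
    exact ⟨i, hi, hG⟩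
  refine (measureReal_mono hsub (measure_ne_top _ _)).trans ((measureReal_biUnion_finset_le _ _).trans ?_)
  have hterm : ∀ i ∈ (univ : Finset (ι n)).filter (fun i => c * (n : ℝ) ^ s ≤ #(F n i)),
      (KGraph.binomialRandom k (Fin n) (p n)).real
        {G | ∀ t ∈ F n i, ¬ IsPathPower k h G.edges (List.ofFn t)} ≤
      Real.exp (-(c / (4 * (s + 1 : ℝ) ^ s) *
          (n : ℝ) ^ (1 + 1 / (2 * (h.choose (k - 1) : ℝ))))) := fun i hi =>
    (binomialRandom_real_avoid_le (by omega) _ _).trans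
      (avoidProb_powEdges_le hk hkh hh hε hεs hc hn (p n).2.2 hpn _ (hF n i) (mem_filter.1 hi).2)
  refine (sum_le_sum hterm).trans ?_
  rw [sum_const, nsmul_eq_mul]
  refine mul_le_mul_of_nonneg_right ?_ (Real.exp_pos _).le
  calc (_ : ℝ) ≤ (Fintype.card (ι n) : ℝ) := by exact_mod_cast card_le_univ _
    _ ≤ (((n + 1) ^ (B * n) : ℕ) : ℝ) := by exact_mod_cast hι n hn
    _ = _ := by push_cast; rfl

end Hitting

/-! ### Greedy selection by multiplicative weights, and greedy counting. -/

section Greedy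

open Finset

open Classical in
/-- Multiplicative weights: if one can always add an element which hits a constant proportion of
the items, weighted by `2⁻ᶜ` where `c` counts the previous hits, then all items get hit often. -/
lemma exists_list_hits {X I : Type*} [Fintype I] (hit : X → I → Prop) (P : List X → Prop)
    (hP : P []) {c : ℝ} (hc1 : c ≤ 1) (m : ℕ)
    (step : ∀ l, P l → l.length < m → ∃ x, P (x :: l) ∧
      c * ∑ i, (1 / 2 : ℝ) ^ l.countP (fun y => hit y i) ≤
        ∑ i with hit x i, (1 / 2 : ℝ) ^ l.countP (fun y => hit y i)) :
    ∃ l, P l ∧ l.length = m ∧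
      ∀ i, c / 2 * m - Real.log (Fintype.card I) ≤ l.countP (fun y => hit y i) := by
  -- Potential argument: each step halves the weight of the items hit, at least a proportion `c` of
  -- the total, so the total falls by the factor `1 - c / 2`. It always bounds the weight of any
  -- single item.
  suffices hs : ∀ j ≤ m, ∃ l, P l ∧ l.length = j ∧
      ∑ i, (1 / 2 : ℝ) ^ l.countP (fun y => hit y i) ≤ Fintype.card I * (1 - c / 2) ^ j by
    obtain ⟨l, hl, hlen, hsum⟩ := hs m le_rfl
    refine ⟨l, hl, hlen, fun i => ?_⟩
    have h1 : (1 / 2 : ℝ) ^ l.countP (fun y => hit y i) ≤ Fintype.card I * (1 - c / 2) ^ m :=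
      (single_le_sum (f := fun i => (1 / 2 : ℝ) ^ l.countP (fun y => hit y i))
        (fun i _ => by positivity) (mem_univ i)).trans hsum
    have hI : (0 : ℝ) < Fintype.card I := by exact_mod_cast Fintype.card_pos_iff.2 ⟨i⟩
    have h2 : (1 / 2 : ℝ) ^ l.countP (fun y => hit y i) ≤
        Fintype.card I * Real.exp (-(c / 2 * m)) := by
      refine h1.trans (mul_le_mul_of_nonneg_left ?_ hI.le)
      have : Real.exp (-(c / 2 * m)) = Real.exp (-(c / 2)) ^ m := by
        rw [← Real.exp_nat_mul]; congr 1; ring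
      rw [this]
      exact pow_le_pow_left₀ (by linarith) (by linarith [Real.add_one_le_exp (-(c / 2))]) _
    have h3 := Real.log_le_log (by positivity) h2
    rw [Real.log_pow, Real.log_mul hI.ne' (Real.exp_pos _).ne', Real.log_exp, one_div,
      Real.log_inv] at h3
    have h4 : Real.log 2 ≤ 1 := by linarith [Real.log_two_lt_d9]
    have h5 : (l.countP (fun y => hit y i) : ℝ) * Real.log 2 ≤ l.countP (fun y => hit y i) :=
      mul_le_of_le_one_right (Nat.cast_nonneg _) h4
    linarith
  intro j hj
  induction j with
  | zero => exact ⟨[], hP, rfl, by simp⟩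
  | succ j ih =>
    obtain ⟨l, hl, hlen, hsum⟩ := ih (by omega)
    obtain ⟨x, hx, hstep⟩ := step l hl (by omega)
    refine ⟨x :: l, hx, by simp [hlen], ?_⟩
    have h1 : ∑ i, (1 / 2 : ℝ) ^ (x :: l).countP (fun y => hit y i) =
        ∑ i, (1 / 2 : ℝ) ^ l.countP (fun y => hit y i) -
          1 / 2 * ∑ i with hit x i, (1 / 2 : ℝ) ^ l.countP (fun y => hit y i) := by
      rw [sum_filter, mul_sum, ← sum_sub_distrib]
      refine sum_congr rfl fun i _ => ?_
      by_cases hxi : hit x i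
      · rw [List.countP_cons_of_pos (by simpa using hxi), pow_succ, if_pos hxi]
        ring
      · rw [List.countP_cons_of_neg (by simpa using hxi), if_neg hxi]
        ring
    rw [h1, pow_succ]
    have h2 : (∑ i, (1 / 2 : ℝ) ^ l.countP (fun y => hit y i)) * (1 - c / 2) ≤
        Fintype.card I * (1 - c / 2) ^ j * (1 - c / 2) :=
      mul_le_mul_of_nonneg_right hsum (by linarith)
    linarith

variable {V : Type*} [DecidableEq V]

/-- Lists store the choices latest first, so different sequences of choices give different lists and
the numbers of choices multiply. -/
lemma exists_finset_lists (Good : List V → Prop) (h0 : Good []) {q : ℝ} (hq : 0 ≤ q) (m : ℕ)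
    (step : ∀ l, Good l → l.length < m → ∃ N : Finset V, q ≤ #N ∧ ∀ v ∈ N, Good (v :: l)) :
    ∃ L : Finset (List V), q ^ m ≤ #L ∧ ∀ l ∈ L, l.length = m ∧ Good l := by
  suffices hs : ∀ j ≤ m, ∃ L : Finset (List V), q ^ j ≤ #L ∧ ∀ l ∈ L, l.length = j ∧ Good l from
    hs m le_rfl
  intro j hj
  induction j with
  | zero => exact ⟨{[]}, by simp, by simpa using h0⟩
  | succ j ih =>
    obtain ⟨L, hcard, hL⟩ := ih (by omega)
    have hN : ∀ l : List V, ∃ N : Finset V, l ∈ L → q ≤ #N ∧ ∀ v ∈ N, Good (v :: l) := by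
      intro l
      by_cases hl : l ∈ L
      · obtain ⟨N, h1, h2⟩ := step l (hL l hl).2 (by rw [(hL l hl).1]; omega)
        exact ⟨N, fun _ => ⟨h1, h2⟩⟩
      · exact ⟨∅, fun h => absurd h hl⟩
    choose N hN using hN
    refine ⟨L.biUnion fun l => (N l).image (· :: l), ?_, ?_⟩
    · rw [card_biUnion, Nat.cast_sum, pow_succ]
      · calc q ^ j * q ≤ #L * q := mul_le_mul_of_nonneg_right hcard hq
          _ = ∑ l ∈ L, q := by rw [sum_const, nsmul_eq_mul]
          _ ≤ _ := sum_le_sum fun l hl => by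
            rw [card_image_of_injective _ (fun a b hab => (List.cons.inj hab).1)]
            exact (hN l hl).1
      · intro l _ l' _ hne
        rw [Function.onFun, disjoint_left]
        intro z hz hz'
        rw [mem_image] at hz hz'
        obtain ⟨v, _, rfl⟩ := hz
        obtain ⟨v', _, hv'⟩ := hz'
        exact hne (List.cons.inj hv').2.symm
    · intro z hz
      simp only [mem_biUnion, mem_image] at hz
      obtain ⟨l, hl, v, hv, rfl⟩ := hz
      exact ⟨by simp [(hL l hl).1], (hN l hl).2 v hv⟩

/-- In use, `φ` rearranges a list from the order of choice to the order along the path. -/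
lemma card_le_card_tuples [Fintype V] {s : ℕ} (L : Finset (List V))
    (φ : List V → List V) (hφ : Set.InjOn φ L) (hlen : ∀ l ∈ L, (φ l).length = s)
    (T : Finset (Fin s → V)) (hT : ∀ t : Fin s → V, (∃ l ∈ L, φ l = List.ofFn t) → t ∈ T) :
    #L ≤ #T := by
  rw [← card_image_of_injOn hφ, ← card_image_of_injective T (List.ofFn_injective (n := s))]
  refine card_le_card fun z hz => ?_
  obtain ⟨l, hl, rfl⟩ := mem_image.1 hz
  have h1 : List.ofFn (fun i : Fin s => (φ l)[i.val]'(by rw [hlen l hl]; exact i.2)) = φ l := by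
    refine List.ext_getElem (by simp [hlen l hl]) fun i h1 h2 => by simp
  exact mem_image.2 ⟨_, hT _ ⟨l, hl, h1.symm⟩, h1⟩

end Greedy

/-! ### Common neighbourhoods under the codegree condition. -/

section CommonNeighbours

open Finset

variable {V : Type*} [Fintype V] [DecidableEq V] {k h : ℕ}

open Classical in
/-- The vertices which form an edge of `E` with each `(k - 1)`-element subset of `X`. -/
noncomputable def commonNbhd (k : ℕ) (E : Set (Finset V)) (X : Finset V) : Finset V :=
  univ.filter fun v => ∀ S ⊆ X, #S = k - 1 → insert v S ∈ E

lemma mem_commonNbhd {E : Set (Finset V)} {X : Finset V} {v : V} :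
    v ∈ commonNbhd k E X ↔ ∀ S ⊆ X, #S = k - 1 → insert v S ∈ E := by
  simp [commonNbhd]

lemma IsPathPower.cons_of_mem {E E' : Set (Finset V)} (hE : E ⊆ E') {v : V} {z : List V}
    (hz : IsPathPower k h E' z) (hv : v ∈ commonNbhd k E (z.take h).toFinset) :
    IsPathPower k h E' (v :: z) :=
  hz.cons fun S hS hc => hE (mem_commonNbhd.1 hv S hS hc)

lemma IsPathPower.concat_of_mem {E E' : Set (Finset V)} (hE : E ⊆ E') (hk : 2 ≤ k) (hh : 1 ≤ h)
    {v : V} {z : List V} (hz : IsPathPower k h E' z)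
    (hv : v ∈ commonNbhd k E (z.reverse.take h).toFinset) :
    IsPathPower k h E' (z ++ [v]) :=
  hz.concat (fun S hS hc => hE (mem_commonNbhd.1 hv S hS hc)) hk hh

omit [Fintype V] in
lemma card_take_toFinset_le (z : List V) : #(z.take h).toFinset ≤ h :=
  (List.toFinset_card_le _).trans (by simp)

lemma KGraph.minCodegree_le_card_filter (H : KGraph k V) (hk : 1 ≤ k) {S : Finset V}
    (hS : #S = k - 1) [DecidablePred fun v => insert v S ∈ H.edges] :
    H.minCodegree ≤ #{v | insert v S ∈ H.edges} := by
  have h1 : H.minCodegree ≤ H.degree S := Nat.sInf_le ⟨S, hS, rfl⟩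
  refine h1.trans ?_
  rw [KGraph.degree]
  have h2 : H.neighborhood S ⊆
      (((univ.filter fun v => insert v S ∈ H.edges).image fun v => ({v} : Finset V)) :
        Finset (Finset V)) := by
    rintro T ⟨hT, hE⟩
    obtain ⟨v, rfl⟩ := card_eq_one.1 (show #T = 1 by omega)
    rw [mem_coe, mem_image]
    exact ⟨v, mem_filter.2 ⟨mem_univ _, by rwa [insert_eq, union_comm]⟩, rfl⟩
  refine (Set.ncard_le_ncard h2 (finite_toSet _)).trans ?_
  rw [Set.ncard_coe_finset]
  exact card_image_le

/-- A union bound: `X` has at most `C` subsets of size `k - 1`, and each excludes at most `(1 / C -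
α) * n` vertices. This is where the codegree threshold comes from. -/
lemma KGraph.le_card_commonNbhd (H : KGraph k V) (hk : 2 ≤ k) (hkh : k ≤ h + 1) {α : ℝ}
    (hα : 0 ≤ α)
    (hdeg : (1 - (h.choose (k - 1) : ℝ)⁻¹ + α) * (Fintype.card V : ℝ) ≤ H.minCodegree)
    {X : Finset V} (hX : #X ≤ h) :
    min α 1 * Fintype.card V ≤ #(commonNbhd k H.edges X) := by
  classical
  set C := h.choose (k - 1) with hC
  have hCpos : 0 < C := Nat.choose_pos (by omega)
  have hC1 : (1 : ℝ) ≤ C := by exact_mod_cast hCpos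
  set N : ℝ := (Fintype.card V : ℝ) with hN
  have hN0 : 0 ≤ N := Nat.cast_nonneg _
  have hcompl : #(commonNbhd k H.edges X)ᶜ ≤
      ∑ S ∈ powersetCard (k - 1) X, #{v | ¬ insert v S ∈ H.edges} := by
    refine (card_le_card fun v hv => ?_).trans card_biUnion_le
    rw [mem_compl, mem_commonNbhd] at hv
    push Not at hv
    obtain ⟨S, hS, hc, hE⟩ := hv
    exact mem_biUnion.2 ⟨S, mem_powersetCard.2 ⟨hS, hc⟩, mem_filter.2 ⟨mem_univ _, hE⟩⟩
  have hterm : ∀ S ∈ powersetCard (k - 1) X,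
      (#{v | ¬ insert v S ∈ H.edges} : ℝ) ≤ ((C : ℝ)⁻¹ - α) * N := by
    intro S hS
    have h1 := H.minCodegree_le_card_filter (by omega) (mem_powersetCard.1 hS).2
    have h2 := card_filter_add_card_filter_not (s := (univ : Finset V))
      (fun v => insert v S ∈ H.edges)
    rw [card_univ] at h2
    have h1' : (H.minCodegree : ℝ) ≤ (#{v | insert v S ∈ H.edges} : ℝ) := by exact_mod_cast h1
    have h2' : (#{v | insert v S ∈ H.edges} : ℝ) + (#{v | ¬ insert v S ∈ H.edges} : ℝ) = N := by
      rw [hN]; exact_mod_cast h2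
    nlinarith
  have hPC : #(powersetCard (k - 1) X) ≤ C := by
    rw [card_powersetCard]
    exact Nat.choose_le_choose _ hX
  have htotal : (#(commonNbhd k H.edges X)ᶜ : ℝ) ≤ (1 - min α 1) * N := by
    have h1 : (#(commonNbhd k H.edges X)ᶜ : ℝ) ≤
        #(powersetCard (k - 1) X) * (((C : ℝ)⁻¹ - α) * N) := by
      calc (#(commonNbhd k H.edges X)ᶜ : ℝ)
          ≤ ((∑ S ∈ powersetCard (k - 1) X, #{v | ¬ insert v S ∈ H.edges} : ℕ) : ℝ) := by
            exact_mod_cast hcompl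
        _ = ∑ S ∈ powersetCard (k - 1) X, (#{v | ¬ insert v S ∈ H.edges} : ℝ) := by
            push_cast; rfl
        _ ≤ _ := by
            refine (sum_le_sum hterm).trans ?_
            rw [sum_const, nsmul_eq_mul]
    -- Replacing the number of subsets by `C` is only valid for a nonnegative bound per subset; when
    -- `α > 1 / C` the trivial bound zero is used.
    rcases le_or_gt 0 (((C : ℝ)⁻¹ - α) * N) with hpos | hneg
    · have h2 : (#(powersetCard (k - 1) X) : ℝ) * (((C : ℝ)⁻¹ - α) * N)
          ≤ C * (((C : ℝ)⁻¹ - α) * N) :=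
        mul_le_mul_of_nonneg_right (by exact_mod_cast hPC) hpos
      have h3 : C * (((C : ℝ)⁻¹ - α) * N) = (1 - C * α) * N := by field_simp
      have h4 : min α 1 ≤ C * α := (min_le_left _ _).trans (le_mul_of_one_le_left hα hC1)
      nlinarith
    · have h2 : (#(powersetCard (k - 1) X) : ℝ) * (((C : ℝ)⁻¹ - α) * N) ≤ 0 :=
        mul_nonpos_of_nonneg_of_nonpos (Nat.cast_nonneg _) hneg.le
      have h3 : 0 ≤ (1 - min α 1) * N := mul_nonneg (by linarith [min_le_right α 1]) hN0
      linarith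
  have h1 := card_add_card_compl (commonNbhd k H.edges X)
  have h2 : (#(commonNbhd k H.edges X) : ℝ) + #(commonNbhd k H.edges X)ᶜ = N := by
    rw [hN]; exact_mod_cast h1
  linarith

end CommonNeighbours

/-! ### Absorbers and connectors form dense families. -/

section Families

open Finset

variable {V : Type*} [Fintype V] [DecidableEq V] {k h : ℕ}

open Classical in
/-- The injective tuples with all entries in `W`. -/
noncomputable def tuplesIn (s : ℕ) (W : Finset V) : Finset (Fin s → V) :=
  univ.filter fun t => Function.Injective t ∧ ∀ i, t i ∈ W

/-- The vertex `v` can be inserted in the middle of the list `t`. -/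
def AbsorbsVertex (k h : ℕ) (E : Set (Finset V)) (t : List V) (v : V) : Prop :=
  IsPathPower k h E (t.take h ++ v :: t.drop h)

open Classical in
/-- The injective tuples in `W` which absorb a proportion at least `c` of the vertices, where
vertex `v` has weight `2 ^ (-w v)`. -/
noncomputable def absorberFamily (k h : ℕ) (E : Set (Finset V)) (c : ℝ) (w : V → ℕ)
    (W : Finset V) : Finset (Fin (2 * h) → V) :=
  (tuplesIn (2 * h) W).filter fun t => c * ∑ v, (1 / 2 : ℝ) ^ w v ≤
    ∑ v with AbsorbsVertex k h E (List.ofFn t) v, (1 / 2 : ℝ) ^ w v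

/-- The two halves of `c` extend the path powers `x` forwards and `y` backwards, using only edges
of `E` for the new edges. -/
def Connects (k h : ℕ) (E : Set (Finset V)) (x y c : List V) : Prop :=
  ∀ E', E ⊆ E' → (IsPathPower k h E' x → IsPathPower k h E' (x ++ c.take h)) ∧
    (IsPathPower k h E' y → IsPathPower k h E' (c.drop h ++ y))

open Classical in
/-- The injective tuples in `W` which connect `x` to `y`. -/
noncomputable def connectorFamily (k h : ℕ) (E : Set (Finset V)) (x y : List V) (W : Finset V) :
    Finset (Fin (2 * h) → V) :=
  (tuplesIn (2 * h) W).filter fun t => Connects k h E x y (List.ofFn t)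

lemma injective_of_mem_tuplesIn {s : ℕ} {W : Finset V} {t : Fin s → V} (ht : t ∈ tuplesIn s W) :
    Function.Injective t := by
  classical exact (mem_filter.1 ht).2.1

lemma mem_tuplesIn_of_ofFn {s : ℕ} {W : Finset V} {t : Fin s → V} {l : List V}
    (hl : l = List.ofFn t) (hnd : l.Nodup) (hW : ∀ v ∈ l, v ∈ W) : t ∈ tuplesIn s W := by
  classical
  subst hl
  exact mem_filter.2 ⟨mem_univ _, List.nodup_ofFn.1 hnd,
    fun i => hW _ (List.mem_ofFn.2 ⟨i, rfl⟩)⟩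

lemma ofFn_of_mem_tuplesIn {s : ℕ} {W : Finset V} {t : Fin s → V} (ht : t ∈ tuplesIn s W) :
    (List.ofFn t).length = s ∧ (List.ofFn t).Nodup ∧ ∀ v ∈ List.ofFn t, v ∈ W := by
  classical
  refine ⟨List.length_ofFn, List.nodup_ofFn.2 (injective_of_mem_tuplesIn ht), fun v hv => ?_⟩
  obtain ⟨i, rfl⟩ := List.mem_ofFn.1 hv
  exact (mem_filter.1 ht).2.2 i

lemma card_tuplesIn_ge {s : ℕ} {W : Finset V} {q : ℝ} (hq : 0 ≤ q) (hW : q + s ≤ #W) :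
    q ^ s ≤ #(tuplesIn s W) := by
  obtain ⟨L, hcard, hL⟩ := exists_finset_lists (fun l : List V => l.Nodup ∧ ∀ v ∈ l, v ∈ W)
    (by simp) hq s (fun l hl hlen => by
      refine ⟨W \ l.toFinset, ?_, fun v hv => ?_⟩
      · have h1 := le_card_sdiff l.toFinset W
        have h2 := List.toFinset_card_le l
        have h3 : #W ≤ #(W \ l.toFinset) + s := by omega
        have h4 : (#W : ℝ) ≤ #(W \ l.toFinset) + s := by exact_mod_cast h3
        linarith
      · rw [Finset.mem_sdiff, List.mem_toFinset] at hv
        exact ⟨List.nodup_cons.2 ⟨hv.2, hl.1⟩, by simpa [hv.1] using hl.2⟩)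
  refine hcard.trans ?_
  exact_mod_cast card_le_card_tuples L id (Set.injOn_id _) (fun l hl => (hL l hl).1) _
    fun t ⟨l, hl, hlt⟩ => mem_tuplesIn_of_ofFn hlt (hL l hl).2.1 (hL l hl).2.2

omit [Fintype V] in
lemma card_sdiff_toFinset_ge {W N : Finset V} {l : List V} {q : ℝ} {m : ℕ}
    (hlen : l.length < m) (hN : q + m ≤ #(N ∩ W)) :
    q ≤ #((N ∩ W) \ l.toFinset) := by
  have h1 := le_card_sdiff l.toFinset (N ∩ W)
  have h2 := List.toFinset_card_le l
  have h3 : #(N ∩ W) ≤ #((N ∩ W) \ l.toFinset) + m := by omega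
  have h4 : (#(N ∩ W) : ℝ) ≤ #((N ∩ W) \ l.toFinset) + m := by exact_mod_cast h3
  linarith

/-- The first `h` choices extend `x` to the right and the next `h` extend `y` to the left, each with
`q` options. Nothing is asked of edges between the two halves; the random graph will supply them. -/
lemma card_connectorFamily_ge (hk : 2 ≤ k) (hh : 1 ≤ h) {E : Set (Finset V)} {W : Finset V}
    {q : ℝ} (hq : 0 ≤ q) (hW : ∀ X : Finset V, #X ≤ h → q + (2 * h : ℕ) ≤ #(commonNbhd k E X ∩ W))
    (x y : List V) : q ^ (2 * h) ≤ #(connectorFamily k h E x y W) := by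
  classical
  -- While the first half is being built, `l.length - h` truncates to zero, so the part in front of
  -- `y` is still empty.
  obtain ⟨L, hcard, hL⟩ := exists_finset_lists (fun l : List V => (l.Nodup ∧ ∀ v ∈ l, v ∈ W) ∧
      ∀ E', E ⊆ E' → (IsPathPower k h E' x → IsPathPower k h E' (x ++ l.reverse.take h)) ∧
        (IsPathPower k h E' y → IsPathPower k h E' (l.take (l.length - h) ++ y)))
    (by simp) hq (2 * h) (fun l ⟨hl, hE⟩ hlen => by
      have hbase : ∀ N : Finset V, ∀ v ∈ (N ∩ W) \ l.toFinset,
          (v :: l).Nodup ∧ ∀ u ∈ v :: l, u ∈ W := fun N v hv => by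
        rw [Finset.mem_sdiff, mem_inter, List.mem_toFinset] at hv
        exact ⟨List.nodup_cons.2 ⟨hv.2, hl.1⟩, by simpa [hv.1.2] using hl.2⟩
      by_cases hlh : l.length < h
      · refine ⟨(commonNbhd k E ((x ++ l.reverse.take h).reverse.take h).toFinset ∩ W) \
          l.toFinset, card_sdiff_toFinset_ge hlen (hW _ (card_take_toFinset_le _)),
          fun v hv => ⟨hbase _ v hv, fun E' hE' => ⟨fun hx => ?_, fun hy => ?_⟩⟩⟩
        · have h1 := ((hE E' hE').1 hx).concat_of_mem hE' hk hh
            (mem_inter.1 (Finset.mem_sdiff.1 hv).1).1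
          rw [List.take_of_length_le (by simp; omega)] at h1 ⊢
          simpa using h1
        · have : (v :: l).length - h = 0 := by simp; omega
          rw [this]
          simpa using hy
      · refine ⟨(commonNbhd k E ((l.take (l.length - h) ++ y).take h).toFinset ∩ W) \
          l.toFinset, card_sdiff_toFinset_ge hlen (hW _ (card_take_toFinset_le _)),
          fun v hv => ⟨hbase _ v hv, fun E' hE' => ⟨fun hx => ?_, fun hy => ?_⟩⟩⟩
        · rw [List.reverse_cons, List.take_append_of_le_length (by simp; omega)]
          exact (hE E' hE').1 hx
        · have h1 := ((hE E' hE').2 hy).cons_of_mem hE' (mem_inter.1 (Finset.mem_sdiff.1 hv).1).1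
          have : (v :: l).length - h = (l.length - h) + 1 := by simp; omega
          rw [this, List.take_succ_cons]
          exact h1)
  refine hcard.trans ?_
  have hφlen : ∀ l ∈ L, (l.reverse.take h).length = h := fun l hl => by
    simp [(hL l hl).1]; omega
  have hcat : ∀ l : List V, l.length = 2 * h →
      l.take (l.length - h) ++ (l.reverse.take h).reverse = l := fun l hl => by
    rw [List.take_reverse, List.reverse_reverse, List.take_append_drop]
  have hinj : Set.InjOn (fun l : List V => l.reverse.take h ++ l.take (l.length - h)) L := by
    intro l hl l' hl' heq
    have h1 := List.append_inj heq (by rw [hφlen l hl, hφlen l' hl'])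
    rw [← hcat l (hL l hl).1, ← hcat l' (hL l' hl').1, h1.1, h1.2]
  refine Nat.cast_le.2 (card_le_card_tuples L
    (fun l : List V => l.reverse.take h ++ l.take (l.length - h)) hinj
    (fun l hl => by simp [(hL l hl).1]; omega) _ fun t ⟨l, hl, hlt⟩ => ?_)
  · have hp : l.Perm (l.reverse.take h ++ l.take (l.length - h)) := by
      conv_lhs => rw [← hcat l (hL l hl).1]
      exact List.perm_append_comm.trans ((List.reverse_perm _).append_right _)
    refine mem_filter.2 ⟨mem_tuplesIn_of_ofFn hlt (hp.nodup_iff.1 (hL l hl).2.1.1)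
      fun v hv => (hL l hl).2.1.2 v (hp.mem_iff.2 hv), ?_⟩
    rw [← hlt]
    intro E' hE'
    rw [List.take_left' (hφlen l hl), List.drop_left' (hφlen l hl)]
    exact (hL l hl).2.2 E' hE'

-- Starting from `v`, make `h` extensions to the right and then `h` to the left. The tuple is not
-- required to avoid `v`, which is harmless: only vertices outside all absorbers get absorbed.
open Classical in
lemma card_absorbing_ge (hk : 2 ≤ k) (hh : 1 ≤ h) {E : Set (Finset V)} {W : Finset V}
    {q : ℝ} (hq : 0 ≤ q) (hW : ∀ X : Finset V, #X ≤ h → q + (2 * h : ℕ) ≤ #(commonNbhd k E X ∩ W))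
    (v : V) : q ^ (2 * h) ≤ #{t ∈ tuplesIn (2 * h) W | AbsorbsVertex k h E (List.ofFn t) v} := by
  obtain ⟨L, hcard, hL⟩ := exists_finset_lists (fun l : List V => (l.Nodup ∧ ∀ v ∈ l, v ∈ W) ∧
      IsPathPower k h E (l.take (l.length - h) ++ v :: l.reverse.take h))
    (by
      refine ⟨by simp, ?_⟩
      have : IsPathPower k h E ([] ++ [v]) :=
        IsPathPower.concat trivial (fun S hS hc => by
          have : S = ∅ := by simpa using hS
          subst this
          simp at hc
          omega) hk hh
      simpa using this) hq (2 * h) (fun l ⟨hl, hE⟩ hlen => by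
      have hbase : ∀ N : Finset V, ∀ v ∈ (N ∩ W) \ l.toFinset,
          (v :: l).Nodup ∧ ∀ u ∈ v :: l, u ∈ W := fun N v hv => by
        rw [Finset.mem_sdiff, mem_inter, List.mem_toFinset] at hv
        exact ⟨List.nodup_cons.2 ⟨hv.2, hl.1⟩, by simpa [hv.1.2] using hl.2⟩
      by_cases hlh : l.length < h
      · refine ⟨(commonNbhd k E ((v :: l.reverse.take h).reverse.take h).toFinset ∩ W) \
          l.toFinset, card_sdiff_toFinset_ge hlen (hW _ (card_take_toFinset_le _)),
          fun u hu => ⟨hbase _ u hu, ?_⟩⟩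
        have h0 : l.length - h = 0 := by omega
        rw [h0, List.take_zero, List.nil_append] at hE
        have h1 := hE.concat_of_mem (le_refl E) hk hh (mem_inter.1 (Finset.mem_sdiff.1 hu).1).1
        have : (u :: l).length - h = 0 := by simp; omega
        rw [this, List.take_zero, List.nil_append]
        rw [List.take_of_length_le (by simp; omega)] at h1 ⊢
        simpa using h1
      · refine ⟨(commonNbhd k E ((l.take (l.length - h) ++ v :: l.reverse.take h).take
          h).toFinset ∩ W) \ l.toFinset,
          card_sdiff_toFinset_ge hlen (hW _ (card_take_toFinset_le _)),
          fun u hu => ⟨hbase _ u hu, ?_⟩⟩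
        have h1 := hE.cons_of_mem (le_refl E) (mem_inter.1 (Finset.mem_sdiff.1 hu).1).1
        have : (u :: l).length - h = (l.length - h) + 1 := by simp; omega
        rw [this, List.take_succ_cons, List.reverse_cons,
          List.take_append_of_le_length (by simp; omega)]
        exact h1)
  refine hcard.trans ?_
  have hlen1 : ∀ l ∈ L, (l.take (l.length - h)).length = h := fun l hl => by
    simp [(hL l hl).1]; omega
  have hcat : ∀ l : List V, l.length = 2 * h →
      l.take (l.length - h) ++ (l.reverse.take h).reverse = l := fun l hl => by
    rw [List.take_reverse, List.reverse_reverse, List.take_append_drop]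
  have hinj : Set.InjOn (fun l : List V => l.take (l.length - h) ++ l.reverse.take h) L := by
    intro l hl l' hl' heq
    have h1 := List.append_inj heq (by rw [hlen1 l hl, hlen1 l' hl'])
    rw [← hcat l (hL l hl).1, ← hcat l' (hL l' hl').1, h1.1, h1.2]
  refine Nat.cast_le.2 (card_le_card_tuples L
    (fun l : List V => l.take (l.length - h) ++ l.reverse.take h) hinj
    (fun l hl => by simp [(hL l hl).1]; omega) _ fun t ⟨l, hl, hlt⟩ => ?_)
  · have hp : l.Perm (l.take (l.length - h) ++ l.reverse.take h) := by
      conv_lhs => rw [← hcat l (hL l hl).1]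
      exact (List.reverse_perm _).append_left _
    refine mem_filter.2 ⟨mem_tuplesIn_of_ofFn hlt (hp.nodup_iff.1 (hL l hl).2.1.1)
      fun v hv => (hL l hl).2.1.2 v (hp.mem_iff.2 hv), ?_⟩
    rw [← hlt, AbsorbsVertex, List.take_left' (hlen1 l hl), List.drop_left' (hlen1 l hl)]
    exact (hL l hl).2.2

/-- Double counting: on average a tuple absorbs a weighted proportion at least `2 * c`. Tuples below
`c` contribute at most half of this, so many tuples lie above `c`. -/
lemma card_absorberFamily_ge (hk : 2 ≤ k) (hh : 1 ≤ h) {E : Set (Finset V)} {W : Finset V}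
    {q c : ℝ} (hq : 0 ≤ q)
    (hW : ∀ X : Finset V, #X ≤ h → q + (2 * h : ℕ) ≤ #(commonNbhd k E X ∩ W))
    (hc0 : 0 ≤ c) (hc : 2 * c * (Fintype.card V : ℝ) ^ (2 * h) ≤ q ^ (2 * h))
    (hV : Nonempty V) (w : V → ℕ) :
    c * (Fintype.card V : ℝ) ^ (2 * h) ≤ #(absorberFamily k h E c w W) := by
  classical
  set n := Fintype.card V with hn
  set T := tuplesIn (2 * h) W with hT
  set F := absorberFamily k h E c w W with hF
  set Z : ℝ := ∑ v, (1 / 2 : ℝ) ^ w v with hZ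
  have hZpos : 0 < Z := sum_pos (fun v _ => by positivity) univ_nonempty
  let g : (Fin (2 * h) → V) → ℝ := fun t =>
    ∑ v with AbsorbsVertex k h E (List.ofFn t) v, (1 / 2 : ℝ) ^ w v
  have h1 : 2 * c * (n : ℝ) ^ (2 * h) * Z ≤ ∑ t ∈ T, g t := by
    simp only [g, sum_filter]
    rw [sum_comm, hZ, mul_sum]
    refine sum_le_sum fun v _ => ?_
    rw [← sum_filter, sum_const, nsmul_eq_mul]
    exact mul_le_mul_of_nonneg_right (hc.trans (card_absorbing_ge hk hh hq hW v))
      (by positivity)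
  have h2 : ∑ t ∈ T, g t ≤ #F * Z + (n : ℝ) ^ (2 * h) * (c * Z) := by
    rw [← sum_filter_add_sum_filter_not T (fun t => c * Z ≤ g t)]
    refine add_le_add ?_ ?_
    · calc ∑ t ∈ T with c * Z ≤ g t, g t ≤ ∑ t ∈ T with c * Z ≤ g t, Z :=
            sum_le_sum fun t _ => sum_le_univ_sum_of_nonneg fun v => by positivity
        _ = #F * Z := by rw [sum_const, nsmul_eq_mul]; rfl
    · calc ∑ t ∈ T with ¬ c * Z ≤ g t, g t ≤ ∑ t ∈ T with ¬ c * Z ≤ g t, c * Z :=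
            sum_le_sum fun t ht => (not_le.1 (mem_filter.1 ht).2).le
        _ = #{t ∈ T | ¬ c * Z ≤ g t} * (c * Z) := by rw [sum_const, nsmul_eq_mul]
        _ ≤ (n : ℝ) ^ (2 * h) * (c * Z) := by
            refine mul_le_mul_of_nonneg_right ?_ (by positivity)
            have : #{t ∈ T | ¬ c * Z ≤ g t} ≤ n ^ (2 * h) := by
              refine (card_le_univ _).trans ?_
              simp [hn]
            exact_mod_cast this
  have h3 : c * (n : ℝ) ^ (2 * h) * Z ≤ #F * Z := by linarith
  exact le_of_mul_le_mul_right h3 hZpos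

end Families

/-! ### Building absorbers, connectors, reservoir and covering pieces. -/

section Stages

open Finset

lemma length_flatten_of_forall {α : Type*} {a : ℕ} : ∀ {L : List (List α)},
    (∀ l ∈ L, l.length = a) → L.flatten.length = L.length * a
  | [], _ => by simp
  | l :: L, hL => by
    rw [List.flatten_cons, List.length_append, hL l (by simp),
      length_flatten_of_forall fun l' hl' => hL l' (by simp [hl']), List.length_cons]
    ring

lemma length_flatMap_range_of_forall {α : Type*} {a N : ℕ} {c : ℕ → List α}
    (hc : ∀ i < N, (c i).length = a) : ((List.range N).flatMap c).length = N * a := by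
  rw [List.flatMap_def, length_flatten_of_forall (a := a), List.length_map, List.length_range]
  intro l hl
  obtain ⟨i, hi, rfl⟩ := List.mem_map.1 hl
  exact hc i (List.mem_range.1 hi)

variable {V : Type*} [Fintype V] [DecidableEq V] {k h : ℕ} {E EG : Set (Finset V)}

open Classical in
/-- A small family of disjoint absorbers such that every vertex has linearly many of them. -/
lemma exists_absorbers (hk : 2 ≤ k) (hh : 1 ≤ h) [Nonempty V] {m : ℕ} {q c : ℝ} (hq : 0 ≤ q)
    (hN : ∀ X : Finset V, #X ≤ h → q + (2 * h * (m + 1) : ℕ) ≤ #(commonNbhd k E X))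
    (hc0 : 0 ≤ c) (hc1 : c ≤ 1) (hc : 2 * c * (Fintype.card V : ℝ) ^ (2 * h) ≤ q ^ (2 * h))
    (hit : ∀ w : V → ℕ, (∀ v, w v ≤ m) → ∀ W : Finset V,
      c * (Fintype.card V : ℝ) ^ (2 * h) ≤ #(absorberFamily k h E c w W) →
      ∃ t ∈ absorberFamily k h E c w W, IsPathPower k h EG (List.ofFn t)) :
    ∃ A : List (List V), A.length = m ∧ A.flatten.Nodup ∧
      (∀ t ∈ A, t.length = 2 * h ∧ IsPathPower k h EG t) ∧
      ∀ v, c / 2 * m - Real.log (Fintype.card V) ≤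
        A.countP (fun t => AbsorbsVertex k h E t v) := by
  obtain ⟨A, ⟨h1, h2⟩, h3, h4⟩ := exists_list_hits (fun t v => AbsorbsVertex k h E t v)
    (fun A : List (List V) => A.flatten.Nodup ∧ ∀ t ∈ A, t.length = 2 * h ∧
      IsPathPower k h EG t) (by simp) hc1 m (by
    rintro A ⟨hnd, hA⟩ hlen
    -- With the current counts as weights, a member of `absorberFamily` is exactly what the
    -- multiplicative weights step requires.
    set w : V → ℕ := fun v => A.countP (fun t => AbsorbsVertex k h E t v) with hw
    have hwm : ∀ v, w v ≤ m := fun v => List.countP_le_length.trans hlen.le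
    have hW : ∀ X : Finset V, #X ≤ h →
        q + (2 * h : ℕ) ≤ #(commonNbhd k E X ∩ (univ \ A.flatten.toFinset)) := by
      intro X hX
      have e1 := hN X hX
      have e2 : commonNbhd k E X ∩ (univ \ A.flatten.toFinset)
          = commonNbhd k E X \ A.flatten.toFinset := by ext; simp
      have e3 := le_card_sdiff A.flatten.toFinset (commonNbhd k E X)
      have e4 := List.toFinset_card_le A.flatten
      rw [length_flatten_of_forall fun t ht => (hA t ht).1] at e4
      have e5 : A.length * (2 * h) ≤ m * (2 * h) := Nat.mul_le_mul_right _ hlen.le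
      have e6 : #(commonNbhd k E X) ≤
          #(commonNbhd k E X ∩ (univ \ A.flatten.toFinset)) + m * (2 * h) := by
        rw [e2]; omega
      have e7 : (#(commonNbhd k E X) : ℝ) ≤
          #(commonNbhd k E X ∩ (univ \ A.flatten.toFinset)) + m * (2 * h) := by exact_mod_cast e6
      push_cast at e1 ⊢
      linarith
    obtain ⟨t, ht, htG⟩ := hit w hwm _ (card_absorberFamily_ge hk hh hq hW hc0 hc ‹_› w)
    obtain ⟨ht1, ht2⟩ := mem_filter.1 ht
    obtain ⟨hl1, hl2, hl3⟩ := ofFn_of_mem_tuplesIn ht1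
    refine ⟨List.ofFn t, ⟨?_, ?_⟩, ht2⟩
    · rw [List.flatten_cons, List.nodup_append']
      refine ⟨hl2, hnd, fun v hv hv' => ?_⟩
      have := hl3 v hv
      rw [Finset.mem_sdiff, List.mem_toFinset] at this
      exact this.2 hv'
    · intro t' ht'
      rcases List.mem_cons.1 ht' with rfl | ht'
      · exact ⟨hl1, htG⟩
      · exact hA t' ht')
  exact ⟨A, h3, h1, h2, h4⟩

/-- Only the last `h` entries of `x` and the first `h` of `y` matter, so few families are needed. As
a path power of `EG`, the connector supplies its own middle edges; both halves have length `h`, long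
enough to glue along. -/
lemma exists_connector (hk : 2 ≤ k) (hh : 1 ≤ h) {E' : Set (Finset V)} (hE : E ⊆ E')
    (hEG : EG ⊆ E') {q : ℝ} (hq : 0 ≤ q) {W : Finset V}
    (hW : ∀ X : Finset V, #X ≤ h → q + (2 * h : ℕ) ≤ #(commonNbhd k E X ∩ W))
    (hit : ∀ x y : List V, x.length = h → y.length = h → ∀ W : Finset V,
      q ^ (2 * h) ≤ #(connectorFamily k h E x y W) →
      ∃ t ∈ connectorFamily k h E x y W, IsPathPower k h EG (List.ofFn t))
    {x y : List V} (hx : IsPathPower k h E' x) (hy : IsPathPower k h E' y)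
    (hxl : h ≤ x.length) (hyl : h ≤ y.length) :
    ∃ c : List V, c.length = 2 * h ∧ c.Nodup ∧ (∀ v ∈ c, v ∈ W) ∧
      IsPathPower k h E' (x ++ c) ∧ IsPathPower k h E' (c ++ y) := by
  classical
  obtain ⟨t, ht, htG⟩ := hit (x.drop (x.length - h)) (y.take h) (by simp; omega)
    (by simp; omega) W (card_connectorFamily_ge hk hh hq hW _ _)
  obtain ⟨ht1, ht2⟩ := mem_filter.1 ht
  obtain ⟨hl1, hl2, hl3⟩ := ofFn_of_mem_tuplesIn ht1
  set c := List.ofFn t with hc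
  have hcE := htG.mono hEG
  have hct : (c.take h).length = h := by simp [hl1]; omega
  have hcd : (c.drop h).length = h := by simp [hl1]; omega
  have h0 := ht2 E' hE
  refine ⟨c, hl1, hl2, hl3, ?_, ?_⟩
  · rw [← List.take_append_drop (x.length - h) x] at hx
    have h1 := IsPathPower.glue (by simp; omega) (h0.1 hx.of_append_right) hx
    rw [List.take_append_drop] at h1
    have h2 := IsPathPower.glue (b := c.drop h) hct.ge (by rwa [List.take_append_drop]) h1
    rwa [List.append_assoc, List.take_append_drop] at h2
  · rw [← List.take_append_drop h y] at hy
    have h1 := IsPathPower.glue (by simp; omega) hy (h0.2 hy.of_append_left)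
    rw [List.append_assoc, List.take_append_drop] at h1
    have h2 := IsPathPower.glue (x := c.take h) hcd.ge h1 (by rwa [List.take_append_drop])
    rwa [List.take_append_drop] at h2

/-- Path powers can be connected in turn through a set `R` into which all common neighbourhoods
are large. -/
lemma exists_connectors (hk : 2 ≤ k) (hh : 1 ≤ h) {E' : Set (Finset V)} (hE : E ⊆ E')
    (hEG : EG ⊆ E') {q : ℝ} (hq : 0 ≤ q) {R : Finset V} {N : ℕ}
    (hR : ∀ X : Finset V, #X ≤ h → q + (2 * h * (N + 1) : ℕ) ≤ #(commonNbhd k E X ∩ R))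
    (hit : ∀ x y : List V, x.length = h → y.length = h → ∀ W : Finset V,
      q ^ (2 * h) ≤ #(connectorFamily k h E x y W) →
      ∃ t ∈ connectorFamily k h E x y W, IsPathPower k h EG (List.ofFn t))
    (x y : ℕ → List V)
    (hx : ∀ i < N, IsPathPower k h E' (x i)) (hy : ∀ i < N, IsPathPower k h E' (y i))
    (hxl : ∀ i < N, h ≤ (x i).length) (hyl : ∀ i < N, h ≤ (y i).length) :
    ∃ c : ℕ → List V, (∀ i < N, (c i).length = 2 * h ∧
      IsPathPower k h E' (x i ++ c i) ∧ IsPathPower k h E' (c i ++ y i)) ∧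
      ((List.range N).flatMap c).Nodup ∧ ∀ v ∈ (List.range N).flatMap c, v ∈ R := by
  suffices hs : ∀ j ≤ N, ∃ c : ℕ → List V, (∀ i < j, (c i).length = 2 * h ∧
      IsPathPower k h E' (x i ++ c i) ∧ IsPathPower k h E' (c i ++ y i)) ∧
      ((List.range j).flatMap c).Nodup ∧ ∀ v ∈ (List.range j).flatMap c, v ∈ R from hs N le_rfl
  intro j hj
  induction j with
  | zero => exact ⟨fun _ => [], by simp, by simp, by simp⟩
  | succ j ih =>
    obtain ⟨c, hc, hnd, hcR⟩ := ih (by omega)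
    set used := (List.range j).flatMap c with hused
    have hW : ∀ X : Finset V, #X ≤ h →
        q + (2 * h : ℕ) ≤ #(commonNbhd k E X ∩ (R \ used.toFinset)) := by
      intro X hX
      have e1 := hR X hX
      have e2 : commonNbhd k E X ∩ (R \ used.toFinset)
          = (commonNbhd k E X ∩ R) \ used.toFinset := by ext; simp [and_assoc]
      have e3 := le_card_sdiff used.toFinset (commonNbhd k E X ∩ R)
      have e4 := List.toFinset_card_le used
      rw [hused, length_flatMap_range_of_forall fun i hi => (hc i hi).1, ← hused] at e4
      have e5 : j * (2 * h) ≤ N * (2 * h) := Nat.mul_le_mul_right _ (by omega)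
      have e6 : #(commonNbhd k E X ∩ R) ≤
          #(commonNbhd k E X ∩ (R \ used.toFinset)) + N * (2 * h) := by
        rw [e2]; omega
      have e7 : (#(commonNbhd k E X ∩ R) : ℝ) ≤
          #(commonNbhd k E X ∩ (R \ used.toFinset)) + N * (2 * h) := by exact_mod_cast e6
      push_cast at e1 ⊢
      linarith
    obtain ⟨d, hd1, hd2, hd3, hd4, hd5⟩ := exists_connector hk hh hE hEG hq hW hit
      (hx j (by omega)) (hy j (by omega)) (hxl j (by omega)) (hyl j (by omega))
    have hcongr : (List.range j).flatMap (fun i => if i = j then d else c i) = used := by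
      rw [hused, List.flatMap_def, List.flatMap_def]
      congr 1
      refine List.map_congr_left fun i hi => if_neg ?_
      exact (List.mem_range.1 hi).ne
    have hflat : (List.range (j + 1)).flatMap (fun i => if i = j then d else c i)
        = used ++ d := by
      rw [List.range_succ, List.flatMap_append, hcongr]
      simp
    refine ⟨fun i => if i = j then d else c i, fun i hi => ?_, ?_, ?_⟩
    · by_cases hij : i = j
      · subst hij
        simpa using ⟨hd1, hd4, hd5⟩
      · simpa [hij] using hc i (by omega)
    · rw [hflat, List.nodup_append']
      refine ⟨hnd, hd2, fun v hv hv' => ?_⟩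
      have := hd3 v hv'
      rw [Finset.mem_sdiff, List.mem_toFinset] at this
      exact this.2 hv
    · rw [hflat]
      intro v hv
      rcases List.mem_append.1 hv with hv | hv
      · exact hcR v hv
      · exact (Finset.mem_sdiff.1 (hd3 v hv)).1

lemma commonNbhd_anti {X Y : Finset V} (hXY : X ⊆ Y) : commonNbhd k E Y ⊆ commonNbhd k E X := by
  intro v hv
  rw [mem_commonNbhd] at hv ⊢
  exact fun S hS => hv S (hS.trans hXY)

omit [Fintype V] in
lemma exists_subset_image_fin [Nonempty V] {X : Finset V} (hX : #X ≤ h) :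
    ∃ f : Fin h → V, X ⊆ univ.image f := by
  classical
  refine ⟨fun i => X.toList.getD i (Classical.arbitrary V), fun v hv => ?_⟩
  obtain ⟨i, hi, rfl⟩ := List.mem_iff_getElem.1 (mem_toList.2 hv)
  have hi' : i < h := by rw [length_toList] at hi; omega
  refine mem_image.2 ⟨⟨i, hi'⟩, mem_univ _, ?_⟩
  simp [List.getD_eq_getElem?_getD, List.getElem?_eq_getElem hi]

/-- A small set, disjoint from `U`, containing many vertices of each common neighbourhood. -/
lemma exists_reservoir [Nonempty V] {m : ℕ} {c : ℝ} (hc0 : 0 < c) (hc1 : c ≤ 1) (U : Finset V)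
    (hN : ∀ X : Finset V, #X ≤ h →
      c * (Fintype.card V : ℝ) + #U + m ≤ #(commonNbhd k E X)) :
    ∃ R : Finset V, #R = m ∧ Disjoint R U ∧ ∀ X : Finset V, #X ≤ h →
      c / 2 * m - h * Real.log (Fintype.card V) ≤ #(commonNbhd k E X ∩ R) := by
  classical
  have hn0 : (0 : ℝ) < Fintype.card V := by exact_mod_cast Fintype.card_pos
  have himg : ∀ f : Fin h → V, #(univ.image f) ≤ h := fun f => card_image_le.trans (by simp)
  -- The items are maps from `Fin h`, standing for the sets `X` of size at most `h`. The logarithm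
  -- of their number is only `h * log n`.
  obtain ⟨l, ⟨hnd, hlU⟩, hlen, hl⟩ := exists_list_hits
    (fun (v : V) (f : Fin h → V) => v ∈ commonNbhd k E (univ.image f))
    (fun l : List V => l.Nodup ∧ ∀ v ∈ l, v ∉ U) (by simp) hc1 m (by
    rintro l ⟨hnd, hlU⟩ hlen
    set W := univ \ (U ∪ l.toFinset) with hWdef
    set w : (Fin h → V) → ℝ := fun f =>
      (1 / 2 : ℝ) ^ l.countP (fun v => decide (v ∈ commonNbhd k E (univ.image f))) with hw
    have hw0 : ∀ f, 0 ≤ w f := fun f => by positivity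
    have hW : ∀ f : Fin h → V,
        c * (Fintype.card V : ℝ) ≤ #{v ∈ W | v ∈ commonNbhd k E (univ.image f)} := by
      intro f
      have e1 := hN _ (himg f)
      have e2 : {v ∈ W | v ∈ commonNbhd k E (univ.image f)}
          = commonNbhd k E (univ.image f) \ (U ∪ l.toFinset) := by
        ext v
        simp [hWdef]
        tauto
      have e3 := le_card_sdiff (U ∪ l.toFinset) (commonNbhd k E (univ.image f))
      have e4 := List.toFinset_card_le l
      have e5 := card_union_le U l.toFinset
      have e6 : #(commonNbhd k E (univ.image f)) ≤
          #{v ∈ W | v ∈ commonNbhd k E (univ.image f)} + #U + m := by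
        rw [e2]; omega
      have e7 : (#(commonNbhd k E (univ.image f)) : ℝ) ≤
          #{v ∈ W | v ∈ commonNbhd k E (univ.image f)} + #U + m := by exact_mod_cast e6
      linarith
    have hWne : W.Nonempty := by
      have e1 := hW fun _ => Classical.arbitrary V
      have e2 : (0 : ℝ) < #{v ∈ W | v ∈ commonNbhd k E
          (univ.image fun _ : Fin h => Classical.arbitrary V)} :=
        lt_of_lt_of_le (by positivity) e1
      obtain ⟨v, hv⟩ := card_pos.1 (by exact_mod_cast e2)
      exact ⟨v, (mem_filter.1 hv).1⟩
    -- Averaging over the unused vertices: each item is hit by at least `c * n` of them, hence some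
    -- vertex hits a weighted proportion `c`.
    have hsum : ∑ v ∈ W, c * ∑ f, w f ≤
        ∑ v ∈ W, ∑ f with v ∈ commonNbhd k E (univ.image f), w f := by
      simp only [sum_filter]
      rw [sum_comm, sum_const, nsmul_eq_mul, ← mul_assoc, mul_sum]
      refine sum_le_sum fun f _ => ?_
      rw [← sum_filter, sum_const, nsmul_eq_mul]
      refine mul_le_mul_of_nonneg_right (le_trans ?_ (hW f)) (hw0 f)
      rw [mul_comm]
      refine mul_le_mul_of_nonneg_left ?_ hc0.le
      exact_mod_cast card_le_univ W
    obtain ⟨v, hv, hvsum⟩ := exists_le_of_sum_le hWne hsum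
    simp only [hWdef, Finset.mem_sdiff, mem_union, List.mem_toFinset, mem_univ, true_and,
      not_or] at hv
    refine ⟨v, ⟨List.nodup_cons.2 ⟨hv.2, hnd⟩, ?_⟩, ?_⟩
    · intro u hu
      rcases List.mem_cons.1 hu with rfl | hu
      · exact hv.1
      · exact hlU u hu
    · convert hvsum
      rfl)
  refine ⟨l.toFinset, by rw [List.toFinset_card_of_nodup hnd, hlen], ?_, fun X hX => ?_⟩
  · rw [disjoint_left]
    exact fun v hv => hlU v (List.mem_toFinset.1 hv)
  · obtain ⟨f, hf⟩ := exists_subset_image_fin hX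
    have h1 := hl f
    have h2 : Real.log (Fintype.card (Fin h → V)) = h * Real.log (Fintype.card V) := by
      rw [Fintype.card_fun, Fintype.card_fin, Nat.cast_pow, Real.log_pow]
    rw [h2] at h1
    refine h1.trans ?_
    have h3 : l.countP (fun v => decide (v ∈ commonNbhd k E (univ.image f))) ≤
        #(commonNbhd k E X ∩ l.toFinset) := by
      rw [List.countP_eq_length_filter, ← List.toFinset_card_of_nodup (hnd.filter _)]
      refine card_le_card fun v hv => ?_
      rw [List.mem_toFinset, List.mem_filter] at hv
      exact mem_inter.2 ⟨commonNbhd_anti hf (by simpa using hv.2), List.mem_toFinset.2 hv.1⟩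
    refine le_trans (le_of_eq ?_) (Nat.cast_le.2 h3)
    congr!

/-- If every large set contains a path power on `M` vertices, then disjoint such path powers cover
all but few vertices of any set. -/
lemma exists_pieces {M : ℕ} (hM : 1 ≤ M) {η : ℝ}
    (hit : ∀ W : Finset V, η ≤ #W → ∃ t ∈ tuplesIn M W, IsPathPower k h EG (List.ofFn t))
    (W : Finset V) : ∃ P : List (List V), P.flatten.Nodup ∧ (∀ v ∈ P.flatten, v ∈ W) ∧
      (∀ t ∈ P, t.length = M ∧ IsPathPower k h EG t) ∧ (#(W \ P.flatten.toFinset) : ℝ) ≤ η := by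
  induction hW : #W using Nat.strong_induction_on generalizing W with
  | _ N ih =>
    by_cases hη : (#W : ℝ) ≤ η
    · exact ⟨[], by simp, by simp, by simp, by simpa using hη⟩
    · obtain ⟨t, ht, htG⟩ := hit W (not_le.1 hη).le
      obtain ⟨hl1, hl2, hl3⟩ := ofFn_of_mem_tuplesIn ht
      set l := List.ofFn t with hl
      have hlW : l.toFinset ⊆ W := fun v hv => hl3 v (List.mem_toFinset.1 hv)
      have hcard : #(W \ l.toFinset) < N := by
        rw [card_sdiff_of_subset hlW, List.toFinset_card_of_nodup hl2, hl1]
        have := card_le_card hlW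
        rw [List.toFinset_card_of_nodup hl2, hl1] at this
        omega
      obtain ⟨P, hP1, hP2, hP3, hP4⟩ := ih _ hcard _ rfl
      refine ⟨l :: P, ?_, ?_, ?_, ?_⟩
      · rw [List.flatten_cons, List.nodup_append']
        refine ⟨hl2, hP1, fun v hv hv' => ?_⟩
        exact (Finset.mem_sdiff.1 (hP2 v hv')).2 (List.mem_toFinset.2 hv)
      · intro v hv
        rw [List.flatten_cons, List.mem_append] at hv
        rcases hv with hv | hv
        · exact hl3 v hv
        · exact (Finset.mem_sdiff.1 (hP2 v hv)).1
      · intro t' ht'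
        rcases List.mem_cons.1 ht' with rfl | ht'
        · exact ⟨hl1, htG⟩
        · exact hP3 t' ht'
      · have : W \ (l :: P).flatten.toFinset = (W \ l.toFinset) \ P.flatten.toFinset := by
          ext
          simp [and_assoc]
        rwa [this]

end Stages

/-! ### Assembling the cycle and absorbing the remaining vertices. -/

section Assembly

open Finset

variable {V : Type*} [DecidableEq V] {k h : ℕ} {E : Set (Finset V)}

/-- A cyclic sequence of path powers `T i` and connectors `c i` becomes a spanning cycle once each
uncovered vertex `v` is inserted into its own absorber `T (f v)`. -/
lemma exists_spanning_cycle (hh : 1 ≤ h) {N : ℕ} (hN : 1 ≤ N) (T c : ℕ → List V)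
    (hTlen : ∀ i < N, 2 * h ≤ (T i).length) (hT : ∀ i < N, IsPathPower k h E (T i))
    (hTN : T N = (T 0).take h)
    (hc : ∀ i < N, h ≤ (c i).length ∧ IsPathPower k h E (T i ++ c i) ∧
      IsPathPower k h E (c i ++ T (i + 1)))
    (hnd : ((List.range N).flatMap T ++ (List.range N).flatMap c).Nodup) (f : V → ℕ)
    (hf : ∀ v, v ∉ (List.range N).flatMap T ++ (List.range N).flatMap c →
      f v < N ∧ AbsorbsVertex k h E (T (f v)) v)
    (hfinj : ∀ v, v ∉ (List.range N).flatMap T ++ (List.range N).flatMap c →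
      ∀ v', v' ∉ (List.range N).flatMap T ++ (List.range N).flatMap c → f v = f v' → v = v') :
    ∃ l : List V, l.Nodup ∧ (∀ v, v ∈ l) ∧ 2 * h ≤ l.length ∧
      IsPathPower k h E (l ++ l.take h) := by
  classical
  set B := (List.range N).flatMap T ++ (List.range N).flatMap c with hB
  -- Since `f` is injective on uncovered vertices, each `T i` receives at most one.
  let ins : ℕ → List V := fun i => if hi : ∃ v, v ∉ B ∧ f v = i then [hi.choose] else []
  have hins : ∀ i v, v ∈ ins i ↔ v ∉ B ∧ f v = i := by
    intro i v
    by_cases hi : ∃ v, v ∉ B ∧ f v = i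
    · simp only [ins, dif_pos hi, List.mem_singleton]
      have hs := hi.choose_spec
      constructor
      · rintro rfl
        exact hs
      · rintro ⟨h1, h2⟩
        exact hfinj _ h1 _ hs.1 (h2.trans hs.2.symm)
    · simp only [ins, dif_neg hi, List.not_mem_nil, false_iff]
      exact fun hv => hi ⟨v, hv⟩
  -- `T N` is a copy of the start of `T 0` and must receive nothing. An insertion into `T 0` comes
  -- after its first `h` entries, so the copy stays correct.
  have hinsN : ins N = [] := by
    refine List.eq_nil_iff_forall_not_mem.2 fun v hv => ?_
    have := (hins N v).1 hv
    exact absurd (hf v this.1).1 (by omega)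
  let T' : ℕ → List V := fun i => (T i).take h ++ (ins i ++ (T i).drop h)
  have hT'N : T' N = T N := by simp [T', hinsN]
  have htake : ∀ i ≤ N, ((T i).take h).length = h := by
    intro i hi
    rcases hi.lt_or_eq with hi | rfl
    · have := hTlen i hi
      simp; omega
    · have := hTlen 0 (by omega)
      rw [hTN]
      simp; omega
  have hT'pow : ∀ i < N, IsPathPower k h E (T' i) := by
    intro i hi
    by_cases hex : ∃ v, v ∉ B ∧ f v = i
    · have hs := hex.choose_spec
      have h1 := (hf _ hs.1).2
      rw [hs.2] at h1
      have h2 : T' i = (T i).take h ++ hex.choose :: (T i).drop h := by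
        simp only [T', ins, dif_pos hex, List.singleton_append]
      rw [h2]
      exact h1
    · have h2 : T' i = T i := by
        simp only [T', ins, dif_neg hex, List.nil_append, List.take_append_drop]
      rw [h2]
      exact hT i hi
  -- Insertion leaves the first and last `h` entries of `T i` unchanged, and the connectors see no
  -- others.
  have h1 : ∀ i < N, IsPathPower k h E (T' i ++ c i) := by
    intro i hi
    have e1 := hT'pow i hi
    have e2 := (hc i hi).2.1
    rw [← List.take_append_drop h (T i), List.append_assoc] at e2
    have e3 := IsPathPower.glue (x := (T i).take h ++ ins i)
      (by have := hTlen i hi; simp; omega) e2.of_append_right (by rwa [List.append_assoc])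
    simpa only [T', List.append_assoc] using e3
  have h2 : ∀ i < N, IsPathPower k h E (c i ++ T' (i + 1)) := by
    intro i hi
    have e1 : IsPathPower k h E (T' (i + 1)) := by
      rcases (show i + 1 ≤ N by omega).lt_or_eq with hi' | hi'
      · exact hT'pow _ hi'
      · rw [hi', hT'N, hTN]
        have := hT 0 (by omega)
        rw [← List.take_append_drop h (T 0)] at this
        exact this.of_append_left
    have e2 := (hc i hi).2.2
    rw [← List.take_append_drop h (T (i + 1)), ← List.append_assoc] at e2
    have e3 := IsPathPower.glue (htake (i + 1) (by omega)).ge e1 e2.of_append_left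
    rwa [List.append_assoc] at e3
  have hT'len : ∀ i ≤ N, h ≤ (T' i).length := fun i hi => by
    simp only [T', List.length_append, htake i hi]
    omega
  have hmain := isPathPower_flatMap N hT'len (fun i hi => (hc i hi).1) (hT'pow 0 (by omega)) h1 h2
  set l := (List.range N).flatMap (fun i => T' i ++ c i) with hl
  have hperm : l.Perm (B ++ (List.range N).flatMap ins) := by
    have p1 : ((List.range N).flatMap T' ++ (List.range N).flatMap c).Perm l :=
      List.flatMap_append_perm _ _ _
    have p2 : ((List.range N).flatMap T ++ (List.range N).flatMap ins).Perm
        ((List.range N).flatMap T') := by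
      refine (List.flatMap_append_perm _ _ _).trans (List.Perm.flatMap_left _ fun i _ => ?_)
      simp only [T']
      conv_lhs => rw [← List.take_append_drop h (T i)]
      rw [List.append_assoc]
      exact List.perm_append_comm.append_left _
    refine p1.symm.trans ((p2.symm.append_right _).trans ?_)
    rw [hB, List.append_assoc, List.append_assoc]
    exact List.perm_append_comm.append_left _
  have hinsmem : ∀ v, v ∈ (List.range N).flatMap ins ↔ v ∉ B := by
    intro v
    rw [List.mem_flatMap]
    constructor
    · rintro ⟨i, _, hv⟩
      exact ((hins i v).1 hv).1
    · intro hv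
      exact ⟨f v, List.mem_range.2 (hf v hv).1, (hins _ _).2 ⟨hv, rfl⟩⟩
  refine ⟨l, ?_, ?_, ?_, ?_⟩
  · rw [hperm.nodup_iff, List.nodup_append']
    refine ⟨hnd, List.nodup_flatMap.2 ⟨fun i _ => ?_, ?_⟩, fun v hv hv' => (hinsmem v).1 hv' hv⟩
    · simp only [ins]
      split_ifs <;> simp
    · refine List.nodup_range.imp fun {i j} hij => ?_
      intro v hv hv'
      exact hij (((hins i v).1 hv).2.symm.trans ((hins j v).1 hv').2)
  · intro v
    rw [hperm.mem_iff, List.mem_append, hinsmem]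
    exact em _
  · have hsub : List.Sublist (T' 0) l := by
      obtain ⟨N, rfl⟩ : ∃ N', N = N' + 1 := ⟨N - 1, by omega⟩
      rw [hl, List.range_succ_eq_map, List.flatMap_cons, List.append_assoc]
      exact List.sublist_append_left _ _
    refine le_trans ?_ hsub.length_le
    have := hTlen 0 (by omega)
    simp only [T', List.length_append, List.length_take, List.length_drop]
    omega
  · have : l.take h = T' N := by
      obtain ⟨N, rfl⟩ : ∃ N', N = N' + 1 := ⟨N - 1, by omega⟩
      rw [hT'N, hTN, hl, List.range_succ_eq_map, List.flatMap_cons]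
      simp only [T', List.append_assoc]
      exact List.take_left' (htake 0 (by omega))
    rw [this]
    exact hmain

lemma flatMap_range_getD {α : Type*} (L : List (List α)) :
    (List.range L.length).flatMap (fun i => L.getD i []) = L.flatten := by
  rw [List.flatMap_def]
  congr 1
  refine List.ext_getElem (by simp) fun i h1 h2 => ?_
  simp [List.getD_eq_getElem?_getD, List.getElem?_eq_getElem h2]

lemma card_filter_range_getD {α : Type*} (L : List (List α)) (p : List α → Prop)
    [DecidablePred p] :
    #{i ∈ range L.length | p (L.getD i [])} = L.countP (fun t => p t) := by
  have h1 : (List.range L.length).map (fun i => L.getD i []) = L := by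
    refine List.ext_getElem (by simp) fun i h1 h2 => ?_
    simp [List.getD_eq_getElem?_getD, List.getElem?_eq_getElem h2]
  conv_rhs => rw [← h1, List.countP_map, List.countP_eq_length_filter]
  rfl

/-- Hall's condition is immediate, as each single `I v` is already as large as all of `L`. -/
lemma exists_injOn_of_card_le [Fintype V] (L : Finset V) (I : V → Finset ℕ)
    (hI : ∀ v ∈ L, #L ≤ #(I v)) :
    ∃ f : V → ℕ, (∀ v ∈ L, f v ∈ I v) ∧ ∀ v ∈ L, ∀ v' ∈ L, f v = f v' → v = v' := by
  obtain ⟨g, hg, hgI⟩ := (all_card_le_biUnion_card_iff_exists_injective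
    (fun v : L => I v)).1 (by
      intro s
      rcases s.eq_empty_or_nonempty with rfl | ⟨v, hv⟩
      · simp
      · calc #s ≤ Fintype.card L := card_le_univ s
          _ = #L := Fintype.card_coe L
          _ ≤ #(I v) := hI v v.2
          _ ≤ _ := card_le_card (subset_biUnion_of_mem (fun v : L => I v) hv))
  refine ⟨fun v => if hv : v ∈ L then g ⟨v, hv⟩ else 0, fun v hv => ?_, fun v hv v' hv' heq => ?_⟩
  · dsimp only
    rw [dif_pos hv]
    exact hgI ⟨v, hv⟩
  · dsimp only at heq
    rw [dif_pos hv, dif_pos hv'] at heq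
    exact congrArg Subtype.val (hg heq)

/-- A `k`-graph with large codegree together with a graph hitting all dense families of absorbers
and connectors, and all large vertex sets by long path powers, has a spanning power of a tight
cycle. -/
theorem exists_spanning_cycle_of_hit [Fintype V] [Nonempty V] {EH EG : Set (Finset V)}
    (hEH : EH ⊆ E) (hEG : EG ⊆ E) (hk : 2 ≤ k) (hh : 1 ≤ h) {m mR M : ℕ}
    {ν q₁ q₂ cA cR η : ℝ} (hq₁ : 0 ≤ q₁) (hq₂ : 0 ≤ q₂) (hcA0 : 0 ≤ cA) (hcA1 : cA ≤ 1)
    (hcR0 : 0 < cR) (hcR1 : cR ≤ 1) (hm : 1 ≤ m) (hM : 2 * h ≤ M)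
    (hN : ∀ X : Finset V, #X ≤ h → ν ≤ #(commonNbhd k EH X))
    (hcA : 2 * cA * (Fintype.card V : ℝ) ^ (2 * h) ≤ q₁ ^ (2 * h))
    (hitA : ∀ w : V → ℕ, (∀ v, w v ≤ m) → ∀ W : Finset V,
      cA * (Fintype.card V : ℝ) ^ (2 * h) ≤ #(absorberFamily k h EH cA w W) →
      ∃ t ∈ absorberFamily k h EH cA w W, IsPathPower k h EG (List.ofFn t))
    (hitC : ∀ x y : List V, x.length = h → y.length = h → ∀ W : Finset V,
      q₂ ^ (2 * h) ≤ #(connectorFamily k h EH x y W) →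
      ∃ t ∈ connectorFamily k h EH x y W, IsPathPower k h EG (List.ofFn t))
    (hitP : ∀ W : Finset V, η ≤ #W → ∃ t ∈ tuplesIn M W, IsPathPower k h EG (List.ofFn t))
    -- Room for the absorbers, for the connectors between them, for the reservoir and for the
    -- connectors inside it; lastly, each vertex has at least as many absorbers as there are
    -- vertices left over.
    (h1 : q₁ + (2 * h * (m + 1) : ℕ) ≤ ν)
    (h2 : q₂ + (2 * h * (m + 1) : ℕ) + (2 * h * m : ℕ) ≤ ν)
    (h3 : cR * (Fintype.card V : ℝ) + (4 * h * m : ℕ) + mR ≤ ν)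
    (h4 : ∀ t : ℕ, t * M ≤ Fintype.card V →
      q₂ + (2 * h * (t + 2) : ℕ) ≤ cR / 2 * mR - h * Real.log (Fintype.card V))
    (h5 : mR + η ≤ cA / 2 * m - Real.log (Fintype.card V)) :
    ∃ l : List V, l.Nodup ∧ (∀ v, v ∈ l) ∧ 2 * h ≤ l.length ∧
      IsPathPower k h E (l ++ l.take h) := by
  classical
  obtain ⟨A, hAlen, hAnd, hA, hAcount⟩ := exists_absorbers (EG := EG) hk hh hq₁
    (fun X hX => h1.trans (hN X hX)) hcA0 hcA1 hcA hitA
  have hAfl : A.flatten.length = m * (2 * h) := by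
    rw [length_flatten_of_forall fun t ht => (hA t ht).1, hAlen]
  have hgetA : ∀ i < m, A.getD i [] ∈ A := fun i hi => by
    rw [List.getD_eq_getElem?_getD, List.getElem?_eq_getElem (by omega), Option.getD_some]
    exact List.getElem_mem _
  -- connect consecutive absorbers
  have hR1 : ∀ X : Finset V, #X ≤ h → q₂ + (2 * h * (m - 1 + 1) : ℕ) ≤
      #(commonNbhd k EH X ∩ (univ \ A.flatten.toFinset)) := by
    intro X hX
    have e1 := hN X hX
    have e2 : commonNbhd k EH X ∩ (univ \ A.flatten.toFinset)
        = commonNbhd k EH X \ A.flatten.toFinset := by ext; simp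
    have e3 := le_card_sdiff A.flatten.toFinset (commonNbhd k EH X)
    rw [List.toFinset_card_of_nodup hAnd, hAfl] at e3
    have e6 : #(commonNbhd k EH X) ≤
        #(commonNbhd k EH X ∩ (univ \ A.flatten.toFinset)) + 2 * h * m := by
      rw [e2]
      have : m * (2 * h) = 2 * h * m := by ring
      omega
    have e7 : (#(commonNbhd k EH X) : ℝ) ≤
        #(commonNbhd k EH X ∩ (univ \ A.flatten.toFinset)) + (2 * h * m : ℕ) := by
      exact_mod_cast e6
    have e8 : ((2 * h * (m - 1 + 1) : ℕ) : ℝ) ≤ (2 * h * (m + 1) : ℕ) :=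
      Nat.cast_le.2 (Nat.mul_le_mul_left _ (by omega))
    linarith
  obtain ⟨c₁, hc₁, hc₁nd, hc₁R⟩ := exists_connectors hk hh hEH hEG hq₂ hR1 hitC
    (fun i => A.getD i []) (fun i => A.getD (i + 1) [])
    (fun i hi => (hA _ (hgetA i (by omega))).2.mono hEG)
    (fun i hi => (hA _ (hgetA (i + 1) (by omega))).2.mono hEG)
    (fun i hi => by rw [(hA _ (hgetA i (by omega))).1]; omega)
    (fun i hi => by rw [(hA _ (hgetA (i + 1) (by omega))).1]; omega)
  set C₁ := (List.range (m - 1)).flatMap c₁ with hC₁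
  have hC₁len : C₁.length = (m - 1) * (2 * h) :=
    length_flatMap_range_of_forall fun i hi => (hc₁ i hi).1
  -- the reservoir
  set U := (A.flatten ++ C₁).toFinset with hU
  have hUcard : #U ≤ 4 * h * m := by
    refine (List.toFinset_card_le _).trans ?_
    rw [List.length_append, hAfl, hC₁len]
    have : (m - 1) * (2 * h) ≤ m * (2 * h) := Nat.mul_le_mul_right _ (by omega)
    have e : 4 * h * m = m * (2 * h) + m * (2 * h) := by ring
    omega
  obtain ⟨R, hRcard, hRU, hR⟩ := exists_reservoir (k := k) (h := h) (E := EH) hcR0 hcR1 U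
    (m := mR) (fun X hX => by
      have e1 := hN X hX
      have e2 : (#U : ℝ) ≤ (4 * h * m : ℕ) := by exact_mod_cast hUcard
      linarith)
  -- cover almost all remaining vertices
  obtain ⟨P, hPnd, hPW, hP, hPleft⟩ := exists_pieces (k := k) (h := h) (EG := EG)
    (by omega : 1 ≤ M) hitP (univ \ (U ∪ R))
  set t := P.length with ht
  have hPfl : P.flatten.length = t * M := length_flatten_of_forall fun l hl => (hP l hl).1
  have htM : t * M ≤ Fintype.card V := by
    rw [← hPfl, ← List.toFinset_card_of_nodup hPnd]
    exact card_le_univ _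
  set Q := A ++ P with hQ
  have hQmem : ∀ l ∈ Q, 2 * h ≤ l.length ∧ IsPathPower k h E l := by
    intro l hl
    rcases List.mem_append.1 hl with hl | hl
    · exact ⟨(hA l hl).1.ge, (hA l hl).2.mono hEG⟩
    · exact ⟨hM.trans (hP l hl).1.ge, (hP l hl).2.mono hEG⟩
  have hQlen : Q.length = m + t := by rw [hQ, List.length_append, hAlen]
  set N := m + t with hNdef
  -- Repeating the first `h` vertices of `T 0` at position `N` makes closing the cycle an ordinary
  -- connection.
  let T : ℕ → List V := fun i => if i = N then (A.getD 0 []).take h else Q.getD i []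
  have hTQ : ∀ i < N, T i = Q.getD i [] := fun i hi => if_neg hi.ne
  have hTA : ∀ i < m, T i = A.getD i [] := by
    intro i hi
    rw [hTQ i (by omega), List.getD_eq_getElem?_getD, List.getD_eq_getElem?_getD, hQ,
      List.getElem?_append_left (by omega)]
  have hTmem : ∀ i < N, T i ∈ Q := by
    intro i hi
    rw [hTQ i hi, List.getD_eq_getElem?_getD, List.getElem?_eq_getElem (by omega),
      Option.getD_some]
    exact List.getElem_mem _
  have hTN : T N = (T 0).take h := by
    rw [hTA 0 (by omega)]
    exact if_pos rfl
  have hT1 : ∀ i ≤ N, h ≤ (T i).length ∧ IsPathPower k h E (T i) := by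
    intro i hi
    rcases hi.lt_or_eq with hi | rfl
    · have := hQmem _ (hTmem i hi)
      exact ⟨by omega, this.2⟩
    · have h0 := hQmem _ (hTmem 0 (by omega))
      rw [hTN]
      refine ⟨by rw [List.length_take]; omega, ?_⟩
      have := h0.2
      rw [← List.take_append_drop h (T 0)] at this
      exact this.of_append_left
  -- connect everything else through the reservoir
  obtain ⟨c₂, hc₂, hc₂nd, hc₂R⟩ := exists_connectors (N := t + 1) hk hh hEH hEG hq₂
    (fun X hX => (h4 t htM).trans (hR X hX)) hitC
    (fun j => T (m - 1 + j)) (fun j => T (m - 1 + j + 1))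
    (fun i hi => (hT1 _ (by omega)).2) (fun i hi => (hT1 _ (by omega)).2)
    (fun i hi => (hT1 _ (by omega)).1) (fun i hi => (hT1 _ (by omega)).1)
  set C₂ := (List.range (t + 1)).flatMap c₂ with hC₂
  -- The `m - 1` connectors between absorbers were placed before the reservoir was chosen; only the
  -- other `t + 1` use it. This lets the reservoir be much smaller than the set of absorbers.
  let c : ℕ → List V := fun i => if i < m - 1 then c₁ i else c₂ (i - (m - 1))
  have hc : ∀ i < N, h ≤ (c i).length ∧ IsPathPower k h E (T i ++ c i) ∧
      IsPathPower k h E (c i ++ T (i + 1)) := by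
    intro i hi
    by_cases him : i < m - 1
    · obtain ⟨e1, e2, e3⟩ := hc₁ i him
      simp only [c, if_pos him]
      rw [hTA i (by omega), hTA (i + 1) (by omega)]
      exact ⟨by omega, e2, e3⟩
    · obtain ⟨e1, e2, e3⟩ := hc₂ (i - (m - 1)) (by omega)
      simp only [c, if_neg him]
      rw [show m - 1 + (i - (m - 1)) = i by omega] at e2 e3
      exact ⟨by omega, e2, e3⟩
  have hflatT : (List.range N).flatMap T = Q.flatten := by
    rw [← flatMap_range_getD, hQlen, List.flatMap_def, List.flatMap_def]
    congr 1
    exact List.map_congr_left fun i hi => hTQ i (List.mem_range.1 hi)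
  have hflatc : (List.range N).flatMap c = C₁ ++ C₂ := by
    have e0 : N = (m - 1) + (t + 1) := by omega
    rw [e0, List.range_add, List.flatMap_append, hC₁, hC₂]
    congr 1
    · rw [List.flatMap_def, List.flatMap_def]
      congr 1
      exact List.map_congr_left fun i hi => if_pos (List.mem_range.1 hi)
    · rw [List.flatMap_map, List.flatMap_def, List.flatMap_def]
      congr 1
      refine List.map_congr_left fun i hi => ?_
      simp [c]
  have hC₁A : ∀ v ∈ C₁, v ∉ A.flatten := fun v hv hv' => by
    have := hc₁R v hv
    rw [Finset.mem_sdiff, List.mem_toFinset] at this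
    exact this.2 hv'
  have hPdisj : ∀ v ∈ P.flatten, v ∉ A.flatten ∧ v ∉ C₁ ∧ v ∉ R := fun v hv => by
    have := hPW v hv
    rw [Finset.mem_sdiff, mem_union, hU, List.mem_toFinset, List.mem_append] at this
    tauto
  have hRdisj : ∀ v ∈ R, v ∉ A.flatten ∧ v ∉ C₁ := fun v hv => by
    have := disjoint_left.1 hRU hv
    rw [hU, List.mem_toFinset, List.mem_append] at this
    tauto
  have hnd : ((List.range N).flatMap T ++ (List.range N).flatMap c).Nodup := by
    rw [hflatT, hflatc, hQ, List.flatten_append, List.nodup_append', List.nodup_append',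
      List.nodup_append']
    refine ⟨⟨hAnd, hPnd, fun v hv hv' => (hPdisj v hv').1 hv⟩,
      ⟨hc₁nd, hc₂nd, fun v hv hv' => (hRdisj v (hc₂R v hv')).2 hv⟩, fun v hv hv' => ?_⟩
    rcases List.mem_append.1 hv with hv | hv <;> rcases List.mem_append.1 hv' with hv' | hv'
    · exact hC₁A v hv' hv
    · exact (hRdisj v (hc₂R v hv')).1 hv
    · exact (hPdisj v hv).2.1 hv'
    · exact (hPdisj v hv).2.2 (hc₂R v hv')
  -- absorb the leftover
  set B := (List.range N).flatMap T ++ (List.range N).flatMap c with hB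
  set L := univ.filter fun v => v ∉ B with hL
  -- An uncovered vertex is either an unused vertex of the reservoir or missed by the pieces.
  have hLcard : (#L : ℝ) ≤ mR + η := by
    have e1 : L ⊆ R ∪ ((univ \ (U ∪ R)) \ P.flatten.toFinset) := by
      intro v hv
      have hv := (mem_filter.1 hv).2
      rw [hB, hflatT, hflatc, hQ, List.flatten_append] at hv
      simp only [List.mem_append, not_or] at hv
      simp only [mem_union, Finset.mem_sdiff, mem_univ, true_and, hU, List.mem_toFinset,
        List.mem_append]
      tauto
    have e2 := (card_le_card e1).trans (card_union_le _ _)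
    rw [hRcard] at e2
    have e3 : (#L : ℝ) ≤ mR + #((univ \ (U ∪ R)) \ P.flatten.toFinset) := by exact_mod_cast e2
    linarith
  obtain ⟨f, hf, hfinj⟩ := exists_injOn_of_card_le L
    (fun v => {i ∈ range A.length | AbsorbsVertex k h EH (A.getD i []) v}) (fun v _ => by
      rw [card_filter_range_getD A (fun t => AbsorbsVertex k h EH t v)]
      have := hAcount v
      exact_mod_cast hLcard.trans (h5.trans this))
  refine exists_spanning_cycle hh (by omega : 1 ≤ N) T c
    (fun i hi => (hQmem _ (hTmem i hi)).1) (fun i hi => (hT1 i hi.le).2) hTN hc hnd f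
    (fun v hv => ?_) (fun v hv v' hv' => hfinj v (mem_filter.2 ⟨mem_univ _, hv⟩) v'
      (mem_filter.2 ⟨mem_univ _, hv'⟩))
  have e1 := mem_filter.1 (hf v (mem_filter.2 ⟨mem_univ _, hv⟩))
  have e2 : f v < m := hAlen ▸ mem_range.1 e1.1
  refine ⟨by omega, ?_⟩
  rw [hTA _ e2]
  exact IsPathPower.mono hEH e1.2

end Assembly

/-! ### Choice of constants and conclusion. -/

section Main

open Finset

lemma eventually_add_mul_log_le (a b : ℝ) {c : ℝ} (hc : 0 < c) :
    ∀ᶠ n : ℕ in atTop, a + b * Real.log n ≤ c * n := by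
  have h1 : ∀ᶠ x : ℝ in atTop, ‖b * Real.log x‖ ≤ c / 2 * ‖x‖ :=
    (Real.isLittleO_log_id_atTop.const_mul_left b).def (half_pos hc)
  have h2 : ∀ᶠ x : ℝ in atTop, a ≤ c / 2 * x :=
    (tendsto_id.const_mul_atTop (half_pos hc)).eventually_ge_atTop a
  filter_upwards [tendsto_natCast_atTop_atTop.eventually (h1.and h2)] with n ⟨hn1, hn2⟩
  rw [Real.norm_of_nonneg (Nat.cast_nonneg n)] at hn1
  have := (le_abs_self _).trans hn1
  linarith

variable {k h : ℕ}

/-- The indices are the weights and the allowed vertex set. It matters that weights are counts of at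
most `n`, giving only `n ^ O(n)` families. -/
lemma card_weight_index_le (n : ℕ) (hn : 1 ≤ n) :
    Fintype.card ((Fin n → Fin (n + 1)) × Finset (Fin n)) ≤ (n + 1) ^ (2 * n) := by
  rw [Fintype.card_prod, Fintype.card_fun, Fintype.card_fin, Fintype.card_fin,
    Fintype.card_finset, Fintype.card_fin, two_mul, pow_add]
  exact Nat.mul_le_mul_left _ (Nat.pow_le_pow_left (by omega) _)

lemma card_ends_index_le (h n : ℕ) (hn : 1 ≤ n) :
    Fintype.card ((Fin h → Fin n) × (Fin h → Fin n) × Finset (Fin n)) ≤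
      (n + 1) ^ ((2 * h + 1) * n) := by
  rw [Fintype.card_prod, Fintype.card_prod, Fintype.card_fun, Fintype.card_fin,
    Fintype.card_fin, Fintype.card_finset, Fintype.card_fin]
  have h1 : n ^ h ≤ (n + 1) ^ (h * n) :=
    (Nat.pow_le_pow_left (Nat.le_succ n) h).trans
      (Nat.pow_le_pow_right (by omega) (Nat.le_mul_of_pos_right _ hn))
  have h2 : 2 ^ n ≤ (n + 1) ^ n := Nat.pow_le_pow_left (by omega) _
  calc n ^ h * (n ^ h * 2 ^ n)
      ≤ (n + 1) ^ (h * n) * ((n + 1) ^ (h * n) * (n + 1) ^ n) :=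
        Nat.mul_le_mul h1 (Nat.mul_le_mul h1 h2)
    _ = (n + 1) ^ ((2 * h + 1) * n) := by rw [← pow_add, ← pow_add]; congr 1; ring

lemma card_finset_index_le (n : ℕ) (hn : 1 ≤ n) :
    Fintype.card (Finset (Fin n)) ≤ (n + 1) ^ (1 * n) := by
  rw [Fintype.card_finset, Fintype.card_fin, one_mul]
  exact Nat.pow_le_pow_left (by omega) _

/-- Deterministic part: for large `n`, hitting all dense families suffices. -/
lemma eventually_exists_spanning_cycle (hk : 2 ≤ k) (hh : 2 ≤ h) {ρ : ℝ} (hρ0 : 0 < ρ)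
    (hρ1 : ρ ≤ 1) :
    ∃ (M : ℕ) (cA cC cP : ℝ), 2 * h ≤ M ∧ 0 < cA ∧ 0 < cC ∧ 0 < cP ∧ ∀ᶠ n : ℕ in atTop,
      ∀ (EH EG E : Set (Finset (Fin n))), EH ⊆ E → EG ⊆ E →
      (∀ X : Finset (Fin n), #X ≤ h → ρ * n ≤ #(commonNbhd k EH X)) →
      (∀ i : (Fin n → Fin (n + 1)) × Finset (Fin n),
        cA * (n : ℝ) ^ (2 * h) ≤ #(absorberFamily k h EH cA (fun v => i.1 v) i.2) →
        ∃ t ∈ absorberFamily k h EH cA (fun v => i.1 v) i.2,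
          IsPathPower k h EG (List.ofFn t)) →
      (∀ i : (Fin h → Fin n) × (Fin h → Fin n) × Finset (Fin n),
        cC * (n : ℝ) ^ (2 * h) ≤
          #(connectorFamily k h EH (List.ofFn i.1) (List.ofFn i.2.1) i.2.2) →
        ∃ t ∈ connectorFamily k h EH (List.ofFn i.1) (List.ofFn i.2.1) i.2.2,
          IsPathPower k h EG (List.ofFn t)) →
      (∀ W : Finset (Fin n), cP * (n : ℝ) ^ M ≤ #(tuplesIn M W) →
        ∃ t ∈ tuplesIn M W, IsPathPower k h EG (List.ofFn t)) →
      ∃ l : List (Fin n), l.Nodup ∧ (∀ v, v ∈ l) ∧ 2 * h ≤ l.length ∧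
        IsPathPower k h E (l ++ l.take h) := by
  have hh0 : (0 : ℝ) < h := by exact_mod_cast (by omega : 0 < h)
  have hh2 : (2 : ℝ) ≤ h := by exact_mod_cast hh
  -- Hierarchy of constants. `γ * n` absorbers and their connectors use at most `4 * h * γ * n = ρ *
  -- n / 2` vertices. The leftover is at most `2 * β * n = cA * γ * n / 8`, below the `cA * γ * n /
  -- 2` absorbers of a vertex up to lower order. Common neighbourhoods meet the reservoir in about
  -- `ρ * β * n / 8 = 4 * κ * n` vertices.
  obtain ⟨cA, hcAdef⟩ : ∃ x : ℝ, x = (ρ / 2) ^ (2 * h) / 2 := ⟨_, rfl⟩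
  obtain ⟨γ, hγdef⟩ : ∃ x : ℝ, x = ρ / (8 * h) := ⟨_, rfl⟩
  obtain ⟨β, hβdef⟩ : ∃ x : ℝ, x = cA * γ / 16 := ⟨_, rfl⟩
  obtain ⟨κ, hκdef⟩ : ∃ x : ℝ, x = ρ * β / 32 := ⟨_, rfl⟩
  have hcA0 : 0 < cA := by rw [hcAdef]; positivity
  have hcA1 : cA ≤ 1 := by
    have : (ρ / 2) ^ (2 * h) ≤ 1 := pow_le_one₀ (by positivity) (by linarith)
    rw [hcAdef]; linarith
  have hγ0 : 0 < γ := by rw [hγdef]; positivity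
  have hγh : h * γ = ρ / 8 := by rw [hγdef]; field_simp
  have hγρ : γ ≤ ρ / 16 := by nlinarith
  have hβ0 : 0 < β := by rw [hβdef]; positivity
  have hβγ : β ≤ γ / 16 := by
    rw [hβdef]
    have := mul_le_of_le_one_left hγ0.le hcA1
    linarith
  have hκ0 : 0 < κ := by rw [hκdef]; positivity
  have hκρ : κ ≤ ρ / 32 := by
    rw [hκdef]
    have := mul_le_of_le_one_right hρ0.le (show β ≤ 1 by linarith)
    linarith
  -- At most `n / M` pieces arise, so their connectors use about `2 * h * n / M ≤ κ * n` vertices of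
  -- the reservoir.
  obtain ⟨M, hMge⟩ := exists_nat_ge (2 * h + 2 * h / κ : ℝ)
  have hM2h : 2 * h ≤ M := by
    have : (0 : ℝ) ≤ 2 * h / κ := by positivity
    have : ((2 * h : ℕ) : ℝ) ≤ M := by push_cast; linarith
    exact_mod_cast this
  have hM0 : (0 : ℝ) < M := by exact_mod_cast (by omega : 0 < M)
  have hMκ : 2 * h ≤ κ * M := by
    have : 2 * h / κ ≤ M := by linarith
    rw [div_le_iff₀ hκ0] at this
    linarith
  refine ⟨M, cA, κ ^ (2 * h), (β / 2) ^ M, hM2h, hcA0, by positivity, by positivity, ?_⟩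
  filter_upwards [eventually_ge_atTop 1, eventually_add_mul_log_le 1 0 hγ0,
    eventually_add_mul_log_le (2 * h) 0 (show 0 < ρ / 8 by positivity),
    eventually_add_mul_log_le (4 * h + ρ / 8) h (show 0 < ρ * β / 16 by positivity),
    eventually_add_mul_log_le (cA / 2) 1 (show 0 < 3 * (cA * γ) / 8 by positivity),
    eventually_add_mul_log_le M 0 (show 0 < β / 2 by positivity)]
    with n hn1 hγn hρn hβn hcn hMn EH EG E hEH hEG hN hitA hitC hitP
  have : Nonempty (Fin n) := ⟨⟨0, hn1⟩⟩
  have hn' : (1 : ℝ) ≤ n := by exact_mod_cast hn1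
  have hn0 : (0 : ℝ) < n := by linarith
  have hm1 : (⌊γ * n⌋₊ : ℝ) ≤ γ * n := Nat.floor_le (by positivity)
  have hm2 : γ * n - 1 ≤ ⌊γ * n⌋₊ := (Nat.sub_one_lt_floor _).le
  have hR1 : (⌊β * n⌋₊ : ℝ) ≤ β * n := Nat.floor_le (by positivity)
  have hR2 : β * n - 1 ≤ ⌊β * n⌋₊ := (Nat.sub_one_lt_floor _).le
  have hmn : ⌊γ * n⌋₊ ≤ n := by
    have : (⌊γ * n⌋₊ : ℝ) ≤ n := hm1.trans (mul_le_of_le_one_left hn0.le (by linarith))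
    exact_mod_cast this
  have hhm : h * (⌊γ * n⌋₊ : ℝ) ≤ ρ / 8 * n := by
    calc h * (⌊γ * n⌋₊ : ℝ) ≤ h * (γ * n) := mul_le_mul_of_nonneg_left hm1 hh0.le
      _ = ρ / 8 * n := by rw [← mul_assoc, hγh]
  have hρn0 : 0 < ρ * n := by positivity
  have hκn : κ * n ≤ ρ / 32 * n := mul_le_mul_of_nonneg_right hκρ hn0.le
  have hβn' : β * n ≤ ρ / 256 * n := mul_le_mul_of_nonneg_right (by linarith) hn0.le
  refine exists_spanning_cycle_of_hit (m := ⌊γ * n⌋₊) (mR := ⌊β * n⌋₊) (M := M) (ν := ρ * n)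
    (q₁ := ρ / 2 * n) (q₂ := κ * n) (cA := cA) (cR := ρ / 4) (η := β * n) hEH hEG hk (by omega)
    (by positivity) (by positivity) hcA0.le hcA1 (by positivity) (by linarith) ?_ hM2h hN ?_ ?_
    ?_ ?_ ?_ ?_ ?_ ?_ ?_
  · exact Nat.le_floor (by push_cast; linarith)
  · rw [Fintype.card_fin, mul_pow, hcAdef]
    exact le_of_eq (by ring)
  · intro w hw W hW
    rw [Fintype.card_fin] at hW
    exact hitA (fun v => ⟨w v, by have := hw v; omega⟩, W) hW
  · intro x y hx hy W hW
    have hxe : List.ofFn (fun i : Fin h => x[i.val]'(by omega)) = x :=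
      List.ext_getElem (by simp [hx]) fun i h1 h2 => by simp
    have hye : List.ofFn (fun i : Fin h => y[i.val]'(by omega)) = y :=
      List.ext_getElem (by simp [hy]) fun i h1 h2 => by simp
    have := hitC (fun i : Fin h => x[i.val]'(by omega), fun i : Fin h => y[i.val]'(by omega), W)
    simp only [hxe, hye] at this
    rw [mul_pow] at hW
    exact this hW
  · intro W hW
    refine hitP W ?_
    rw [← mul_pow]
    refine card_tuplesIn_ge (by positivity) ?_
    linarith
  · push_cast
    linarith
  · push_cast
    linarith
  · push_cast
    rw [Fintype.card_fin]
    linarith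
  · intro t ht
    rw [Fintype.card_fin] at ht ⊢
    have ht' : (t : ℝ) * M ≤ n := by exact_mod_cast ht
    have e1 : 2 * h * (t : ℝ) ≤ κ * n := by
      calc 2 * h * (t : ℝ) ≤ κ * M * t := mul_le_mul_of_nonneg_right hMκ (Nat.cast_nonneg t)
        _ = κ * (t * M) := by ring
        _ ≤ κ * n := mul_le_mul_of_nonneg_left ht' hκ0.le
    have e2 : ρ / 8 * (β * n - 1) ≤ ρ / 8 * ⌊β * n⌋₊ :=
      mul_le_mul_of_nonneg_left hR2 (by positivity)
    have e3 : κ * n = ρ * β * n / 32 := by rw [hκdef]; ring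
    push_cast
    linarith
  · rw [Fintype.card_fin]
    have e1 : cA / 2 * (γ * n - 1) ≤ cA / 2 * ⌊γ * n⌋₊ :=
      mul_le_mul_of_nonneg_left hm2 (by positivity)
    have e2 : β * n = cA * γ * n / 16 := by rw [hβdef]; ring
    linarith

end Main

theorem theorem1p3 (k r : ℕ) (hk : 2 ≤ k) (hr : 1 ≤ r) (hkr : 4 ≤ k + r) (α : ℝ) (hα : 0 < α) :
    ∃ ε : ℝ, 0 < ε ∧
      ∀ (H : (n : ℕ) → KGraph k (Fin n)) (p : ℕ → unitInterval),
        (∀ᶠ n : ℕ in atTop,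
          (1 - ((k + r - 2).choose (k - 1) : ℝ)⁻¹ + α) * (n : ℝ) ≤ ((H n).minCodegree : ℝ)) →
        (∀ᶠ n : ℕ in atTop,
          (n : ℝ) ^ (-((k + r - 2).choose (k - 1) : ℝ)⁻¹ - ε) ≤ (p n : ℝ)) →
        Tendsto
          (fun n : ℕ => KGraph.binomialRandom k (Fin n) (p n)
            {G | (H n ∪ G).ContainsTightHamiltonCyclePower r})
          atTop (𝓝 1) := by
  obtain ⟨h, hh⟩ : ∃ h, h = k + r - 2 := ⟨_, rfl⟩
  rw [← hh]
  have hh2 : 2 ≤ h := by omega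
  have hkh : k ≤ h + 1 := by omega
  obtain ⟨M, cA, cC, cP, hM, hcA, hcC, hcP, hdet⟩ :=
    eventually_exists_spanning_cycle (k := k) hk hh2 (lt_min hα one_pos) (min_le_right α 1)
  have hC : (0 : ℝ) < h.choose (k - 1) := by exact_mod_cast Nat.choose_pos (by omega)
  have hM0 : (0 : ℝ) < M := by exact_mod_cast (by omega : 0 < M)
  -- The overlap condition is tightest for the longest tuples, of length `M ≥ 2 * h`. Since `M`
  -- depends only on `k`, `r` and `α`, so does `ε`.
  obtain ⟨ε, hε⟩ : ∃ ε : ℝ, ε = 1 / (2 * (h.choose (k - 1) : ℝ)) / (h.choose (k - 1) * M) :=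
    ⟨_, rfl⟩
  have hε0 : 0 < ε := by rw [hε]; positivity
  have hεM : ε * (h.choose (k - 1) : ℝ) * M ≤ 1 / (2 * (h.choose (k - 1) : ℝ)) := by
    rw [mul_assoc, hε, div_mul_cancel₀ _ (by positivity)]
  have hε2h : ε * (h.choose (k - 1) : ℝ) * (2 * h : ℕ) ≤ 1 / (2 * (h.choose (k - 1) : ℝ)) :=
    (mul_le_mul_of_nonneg_left (Nat.cast_le.2 hM) (by positivity)).trans hεM
  refine ⟨ε, hε0, fun H p hdeg hp => ?_⟩
  classical
  have tA := tendsto_binomialRandom_not_hit hk hkh hh2 hε0.le hε2h hcA 2 p hp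
    (ι := fun n => (Fin n → Fin (n + 1)) × Finset (Fin n)) card_weight_index_le
    (fun n i => absorberFamily k h (H n).edges cA (fun v => i.1 v) i.2)
    (fun n i t ht => injective_of_mem_tuplesIn (Finset.mem_filter.1 ht).1)
  have tC := tendsto_binomialRandom_not_hit hk hkh hh2 hε0.le hε2h hcC (2 * h + 1) p hp
    (ι := fun n => (Fin h → Fin n) × (Fin h → Fin n) × Finset (Fin n)) (card_ends_index_le h)
    (fun n i => connectorFamily k h (H n).edges (List.ofFn i.1) (List.ofFn i.2.1) i.2.2)
    (fun n i t ht => injective_of_mem_tuplesIn (Finset.mem_filter.1 ht).1)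
  have tP := tendsto_binomialRandom_not_hit hk hkh hh2 hε0.le hεM hcP 1 p hp
    (ι := fun n => Finset (Fin n)) card_finset_index_le (fun n W => tuplesIn M W)
    (fun n W t ht => injective_of_mem_tuplesIn ht)
  have tsum := (tA.add tC).add tP
  rw [add_zero, add_zero] at tsum
  -- Failure to contain the cycle forces one of the three hitting properties to fail.
  have hbad : Tendsto (fun n : ℕ => (KGraph.binomialRandom k (Fin n) (p n)).real
      {G | (H n ∪ G).ContainsTightHamiltonCyclePower r}ᶜ) atTop (𝓝 0) := by
    refine squeeze_zero' (Eventually.of_forall fun n => measureReal_nonneg) ?_ tsum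
    filter_upwards [hdet, hdeg] with n hn hdegn
    refine le_trans (measureReal_mono ?_ (measure_ne_top _ _))
      ((measureReal_union_le _ _).trans (add_le_add_left (measureReal_union_le _ _) _))
    intro G hG
    by_contra hnot
    simp only [Set.mem_union, Set.mem_ofPred_eq, not_or, not_not] at hnot
    obtain ⟨⟨gA, gC⟩, gP⟩ := hnot
    obtain ⟨l, hl1, hl2, hl3, hl4⟩ := hn (H n).edges G.edges (H n ∪ G).edges
      Set.subset_union_left Set.subset_union_right (fun X hX => by
        have := (H n).le_card_commonNbhd hk hkh hα.le (by rwa [Fintype.card_fin]) hX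
        rwa [Fintype.card_fin] at this) gA gC gP
    refine hG (IsPathPower.containsTightHamiltonCyclePower (by omega) _ l hl1 hl2 (by omega)
      (by omega) ?_)
    rwa [← hh]
  have hgood : ∀ n : ℕ, KGraph.binomialRandom k (Fin n) (p n)
      {G | (H n ∪ G).ContainsTightHamiltonCyclePower r} =
      ENNReal.ofReal (1 - (KGraph.binomialRandom k (Fin n) (p n)).real
        {G | (H n ∪ G).ContainsTightHamiltonCyclePower r}ᶜ) := by
    intro n
    rw [probReal_compl_eq_one_sub MeasurableSpace.measurableSet_top, sub_sub_cancel,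
      ofReal_measureReal]
  simp only [hgood]
  have := ENNReal.tendsto_ofReal (hbad.const_sub 1)
  simpa using this
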